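/- **Setting.** Let $Y_i=\theta_i+\epsilon_i$, $i=1,\dots,n$, where $\theta\in\mathbb{R}^n$ and $\epsilon_1,\dots,\epsilon_n$ are independent, centred and sub-Gaussian: $\mathbb{E}[e^{t\epsilon_i}]\le e^{t^2/2}$ for all $t\in\mathbb{R}$. A change-point vector is a vector of integers $\tau=(\tau_1<\dots<\tau_{|\tau|})$ of any length $|\tau|\ge 0$ with $1=\tau_0<\tau_1$ and $\tau_{|\tau|}<\tau_{|\tau|+1}=n+1$. Let $\tau^*=(\tau^*_1,\dots,\tau^*_K)$ be the change-point vector of $\theta$, i.e. $\theta_i=\mu_k$ for $\tau^*_{k-1}\le i<\tau^*_k$ with $\mu_k\ne\mu_{k+1}$, and let $\Delta_k=\mu_{k+1}-\mu_k$. For integers $1\le t_1<t_2<t_3\le n+1$, $t=(t_1,t_2,t_3)$ and $v\in\mathbb{R}^n$ put $$\mathbf{C}(v,t)=\Big[\tfrac{\sum_{i=t_2}^{t_3-1}v_i}{t_3-t_2}-\tfrac{\sum_{i=t_1}^{t_2-1}v_i}{t_2-t_1}\Big]\sqrt{\tfrac{(t_2-t_1)(t_3-t_2)}{t_3-t_1}},\qquad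 \psi_q(t)=\sqrt{2\log\Big(\tfrac{n(t_3-t_1)}{(t_3-t_2)(t_2-t_1)}\Big)+q}.$$ The change-point $\tau^*_k$ is $(\kappa,q)$-high-energy if $|\mathbf{C}(\theta,(\tau^*_{k-1},\tau^*_k,\tau^*_{k+1}))|>\kappa\,\psi_q(\tau^*_{k-1},\tau^*_k,\tau^*_{k+1})$. Given $L>1$ and $q>0$, the penalized least-squares estimator $\widehat\tau$ is any minimizer, over all change-point vectors $\tau$, of $$\|Y-\Pi_\tau Y\|^2+L\Big[q|\tau|+2\sum_{i=1}^{|\tau|+1}\log\Big(\frac{n}{\tau_i-\tau_{i-1}}\Big)\Big],$$ where $\Pi_\tau$ is the orthogonal projector onto the vectors that are constant on each $\{\tau_i,\dots,\tau_{i+1}-1\}$. Put $\ell=\min\{(\sqrt L+9)/10,\,2\}$ and let $\mathcal{A}_{L,q}$ be the event that $|\mathbf{C}(\epsilon,t)|\le \ell\,\psi_q(t)$ for all $t=(t_1,t_2,t_3)$ as above. Let $d_{H,1}(\tau,t')=\min_l|\tau_l-t'|$ (equal to $+\infty$ if $\tau$ is empty), and $y_+=\max(y,0)$. **Proposition 10.**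 There exist universal constants $q'_0,c_1,c,c'>0$ such that for every $L>1$ there exists $\kappa_L>1$, depending only on $L$, with the following property. For every $q>q'_0+c_1\log\big[((L\wedge 2)-1)^{-1}\big]$, every $n$, every $\theta\in\mathbb{R}^n$, every noise vector as above, every penalized least-squares estimator $\widehat\tau$ and every $(\kappa_L,q)$-high-energy change-point $\tau^*_k$ of $\theta$, $$\mathbb{P}\left(d_{H,1}(\widehat\tau,\tau^*_k)\,\mathbf{1}_{\mathcal{A}_{L,q}}\ \ge\ c\,x\,\Delta_k^{-2}\right)\le c'e^{-x}$$ for every $x\ge 1+(\log(L-1))_+$, and likewise for every $x\ge 1+(\log((L-1)^{-1}))_+$. -/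

import Mathlib

open MeasureTheory ProbabilityTheory

/-- A change-point vector `(τ_1 < ⋯ < τ_m)` for `n` observations, stored together with the
conventional end points: `pos 0 = τ_0 = 1` and `pos (m + 1) = τ_{m+1} = n + 1`. -/
structure ChangePointVector (n : ℕ) where
  len : ℕ
  pos : Fin (len + 2) → ℕ
  strictMono : StrictMono pos
  pos_zero : pos 0 = 1
  pos_last : pos (Fin.last (len + 1)) = n + 1

namespace ChangePointVector

variable {n : ℕ}

/-- The change-point with (zero-based) index `k`, that is `τ_{k+1}`. -/
def point (τ : ChangePointVector n) (k : Fin τ.len) : ℕ := τ.pos k.succ.castSucc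

/-- The left neighbour of `τ.point k` (possibly the end point `1`). -/
def prev (τ : ChangePointVector n) (k : Fin τ.len) : ℕ := τ.pos k.castSucc.castSucc

/-- The right neighbour of `τ.point k` (possibly the end point `n + 1`). -/
def next (τ : ChangePointVector n) (k : Fin τ.len) : ℕ := τ.pos k.succ.succ

end ChangePointVector

/-- The coordinate `i : Fin n` is the time `i + 1` in `{1, …, n}`; `InSegment a b i` says that this
time lies in `[a, b)`. -/
def InSegment {n : ℕ} (a b : ℕ) (i : Fin n) : Prop := a ≤ (i : ℕ) + 1 ∧ (i : ℕ) + 1 < b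

instance {n : ℕ} (a b : ℕ) (i : Fin n) : Decidable (InSegment a b i) :=
  inferInstanceAs (Decidable (_ ∧ _))

/-- `∑_{i=a}^{b-1} v_i`. -/
noncomputable def segmentSum {n : ℕ} (v : Fin n → ℝ) (a b : ℕ) : ℝ :=
  ∑ i : Fin n, if InSegment a b i then v i else 0

/-- The CUSUM statistic `C(v, (t₁, t₂, t₃))`. For the noise vector it is `N(t)`. -/
noncomputable def cusum {n : ℕ} (v : Fin n → ℝ) (t₁ t₂ t₃ : ℕ) : ℝ :=
  (segmentSum v t₂ t₃ / ((t₃ : ℝ) - t₂) - segmentSum v t₁ t₂ / ((t₂ : ℝ) - t₁)) *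
    √((((t₂ : ℝ) - t₁) * ((t₃ : ℝ) - t₂)) / ((t₃ : ℝ) - t₁))

/-- The energy `E(θ, (t₁, t₂, t₃))`. -/
noncomputable def energy {n : ℕ} (θ : Fin n → ℝ) (t₁ t₂ t₃ : ℕ) : ℝ := |cusum θ t₁ t₂ t₃|

/-- `ψ_q(t₂ - t₁, t₃ - t₂)`, for `n` observations. -/
noncomputable def psi (n : ℕ) (q : ℝ) (t₁ t₂ t₃ : ℕ) : ℝ :=
  √(2 * Real.log (((n : ℝ) * ((t₃ : ℝ) - t₁)) / (((t₃ : ℝ) - t₂) * ((t₂ : ℝ) - t₁))) + q)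

/-- `θ` has change-points vector `τ` and takes the values `m`, with `m_k ≠ m_{k+1}`. -/
structure HasChangePoints {n : ℕ} (θ : Fin n → ℝ) (τ : ChangePointVector n)
    (m : Fin (τ.len + 1) → ℝ) : Prop where
  eq_sum : ∀ i : Fin n, θ i =
    ∑ k : Fin (τ.len + 1), if InSegment (τ.pos k.castSucc) (τ.pos k.succ) i then m k else 0
  ne : ∀ k : Fin τ.len, m k.castSucc ≠ m k.succ

/-- The height `Δ_k` of a change-point. -/
def height {n : ℕ} {τ : ChangePointVector n} (m : Fin (τ.len + 1) → ℝ) (k : Fin τ.len) : ℝ :=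
  m k.succ - m k.castSucc

/-- `τ_k` is a `(κ, q)`-high-energy change-point of `θ`. -/
def IsHighEnergy {n : ℕ} (κ q : ℝ) (θ : Fin n → ℝ) (τ : ChangePointVector n)
    (k : Fin τ.len) : Prop :=
  κ * psi n q (τ.prev k) (τ.point k) (τ.next k) <
    energy θ (τ.prev k) (τ.point k) (τ.next k)

/-- The space of vectors that are constant on each segment `[τ_i, τ_{i+1})`. -/
def piecewiseConstant {n : ℕ} (τ : ChangePointVector n) :
    Submodule ℝ (EuclideanSpace ℝ (Fin n)) where
  carrier := {v | ∀ k : Fin (τ.len + 1), ∀ i j : Fin n,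
    InSegment (τ.pos k.castSucc) (τ.pos k.succ) i →
    InSegment (τ.pos k.castSucc) (τ.pos k.succ) j → v i = v j}
  zero_mem' := fun _ _ _ _ _ => rfl
  add_mem' := fun {v w} hv hw k i j hi hj => by
    simp only [PiLp.add_apply, hv k i j hi hj, hw k i j hi hj]
  smul_mem' := fun a v hv k i j hi hj => by
    simp only [PiLp.smul_apply, hv k i j hi hj]

/-- The multiscale penalty `pen₀(τ, q)`. -/
noncomputable def penalty {n : ℕ} (q : ℝ) (τ : ChangePointVector n) : ℝ :=
  q * τ.len + 2 * ∑ i : Fin (τ.len + 1),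
    Real.log ((n : ℝ) / ((τ.pos i.succ : ℝ) - (τ.pos i.castSucc : ℝ)))

/-- The penalized least-squares criterion `Cr₀(Y, τ) = ‖Y - Π_τ Y‖² + L pen₀(τ, q)`. -/
noncomputable def criterion {n : ℕ} (L q : ℝ) (Y : Fin n → ℝ) (τ : ChangePointVector n) : ℝ :=
  ‖WithLp.toLp 2 Y - (piecewiseConstant τ).starProjection (WithLp.toLp 2 Y)‖ ^ 2
    + L * penalty q τ

/-- `τ` is a penalized least-squares estimate computed from the data `Y`. -/
def IsPenalizedLeastSquares {n : ℕ} (L q : ℝ) (Y : Fin n → ℝ) (τ : ChangePointVector n) : Prop :=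
  ∀ τ' : ChangePointVector n, criterion L q Y τ ≤ criterion L q Y τ'

/-- `d_{H,1}(τ, t)`: the distance from `t` to the closest entry of `τ`; it is infinite when `τ` has
no entry. -/
noncomputable def distTo {n : ℕ} (τ : ChangePointVector n) (t : ℕ) : ENNReal :=
  ⨅ l : Fin τ.len, ENNReal.ofReal |(τ.point l : ℝ) - (t : ℝ)|

/-- The factor `ℓ = ((√L + 9) / 10) ∧ 2`. -/
noncomputable def ell (L : ℝ) : ℝ := min ((√L + 9) / 10) 2

/-- The event `A_{L,q}`: `|N(t)| ≤ ℓ ψ_q(δ(t))` for all triads `1 ≤ t₁ < t₂ < t₃ ≤ n + 1`. -/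
def goodEvent {Ω : Type*} {n : ℕ} (L q : ℝ) (ε : Fin n → Ω → ℝ) : Set Ω :=
  {ω | ∀ t₁ t₂ t₃ : ℕ, 1 ≤ t₁ → t₁ < t₂ → t₂ < t₃ → t₃ ≤ n + 1 →
    |cusum (fun i => ε i ω) t₁ t₂ t₃| ≤ ell L * psi n q t₁ t₂ t₃}

/-- The noise variables are independent, centred and sub-Gaussian with constant `1`:
`E[exp(t ε_i)] ≤ exp(t² / 2)` for all real `t`. -/
structure IsNoise {Ω : Type*} [MeasurableSpace Ω] {n : ℕ} (P : Measure Ω)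
    (ε : Fin n → Ω → ℝ) : Prop where
  measurable : ∀ i, Measurable (ε i)
  indep : iIndepFun ε P
  centred : ∀ i, ∫ ω, ε i ω ∂P = 0
  subgaussian : ∀ i, HasSubgaussianMGF (ε i) 1 P

/-!
Dropping a constant, the criterion is a sum over consecutive pairs of the list `1, τ_1, …, n + 1` of
a cost that depends on the pair only. A minimizer therefore stays optimal when a single stretch of
the list is replaced, and inserting or removing `b` between `a` and `c` changes the criterion by a
squared CUSUM statistic of the data against `L ψ_q²`. On the event `A_{L,q}` the noise alone cannot
pay for a change-point, since `ℓ² < L`.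

Let the signal jump at `T`, with high energy. If no fitted point were within a small fraction of the
distance from `T` to its neighbours, then removing the fitted points close to `T` costs less than
what inserting `T` gains; hence some fitted point is that close. Next, the fitted interval around
`T` has an end close to `T`, and unless this end is within `d` of `T` moving it to `T` is
profitable, provided that the mean of the noise over each stretch of length at least `d` starting or
ending at `T` is below `|Δ| / 40`. By the maximal inequality for the exponential martingale of the
noise this fails on either side with probability at most `2 exp (-(|Δ| / 40)² d / 2)`, which is
`2 exp (-x)` for `d = 3200 x / Δ²`.
-/

section SubgaussianWalk

variable {Ω ι κ : Type*} [MeasurableSpace Ω] {P : Measure Ω}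

theorem iIndepFun_extend_const {β : Type*} [MeasurableSpace β] {X : κ → Ω → β}
    (hX : iIndepFun X P) {g : κ → ι} (hg : g.Injective) (c : β) :
    iIndepFun (Function.extend g X fun _ _ => c) P := by
  classical
  have := hX.isProbabilityMeasure
  set Z := Function.extend g X fun _ _ => c
  have apply_range : ∀ k, Z (g k) = X k := hg.extend_apply X _
  have apply_compl : ∀ i ∉ Set.range g, Z i = fun _ => c := fun i hi =>
    Function.extend_apply' _ _ _ hi
  refine iIndepFun_iff_measure_inter_preimage_eq_mul.2 fun S A hA => ?_
  by_cases hc : ∀ i ∈ S, i ∉ Set.range g → c ∈ A i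
  · have preimage_eq_univ : ∀ i ∈ S, i ∉ Set.range g → Z i ⁻¹' A i = Set.univ := fun i hi hig => by
      simp [apply_compl i hig, hc i hi hig]
    have hinter : ⋂ i ∈ S, Z i ⁻¹' A i = ⋂ k ∈ S.preimage g hg.injOn, X k ⁻¹' A (g k) := by
      ext ω
      simp only [Set.mem_iInter, Finset.mem_preimage]
      refine ⟨fun h k hk => by simpa only [apply_range] using h (g k) hk, fun h i hi => ?_⟩
      by_cases hig : i ∈ Set.range g
      · obtain ⟨k, rfl⟩ := hig
        simpa only [apply_range] using h k hi
      · simp [preimage_eq_univ i hi hig]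
    rw [hinter, hX.measure_inter_preimage_eq_mul _ fun k hk => hA _ (Finset.mem_preimage.1 hk),
      ← Finset.prod_preimage g S hg.injOn _ fun i hi hig => by
        rw [preimage_eq_univ i hi hig, measure_univ]]
    simp only [apply_range]
  · push Not at hc
    obtain ⟨i, hi, hig, hci⟩ := hc
    have hempty : Z i ⁻¹' A i = ∅ := by simp [apply_compl i hig, hci]
    rw [Finset.prod_eq_zero hi (by rw [hempty, measure_empty])]
    exact measure_mono_null (Set.biInter_subset_of_mem hi) (by rw [hempty, measure_empty])

theorem martingale_prod_range_succ {Y : ℕ → Ω → ℝ} (hY : ∀ i, StronglyMeasurable (Y i))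
    (hind : iIndepFun Y P) (hint : ∀ i, Integrable (Y i) P) (hmean : ∀ i, ∫ ω, Y i ω ∂P = 1) :
    Martingale (fun j => ∏ i ∈ Finset.range (j + 1), Y i) (Filtration.natural Y hY) P := by
  have := hind.isProbabilityMeasure
  have hadp : ∀ j, StronglyMeasurable[Filtration.natural Y hY j]
      (∏ i ∈ Finset.range (j + 1), Y i) := fun j =>
    Finset.stronglyMeasurable_prod _ fun i hi =>
      (Filtration.stronglyAdapted_natural hY i).mono
        ((Filtration.natural Y hY).mono (Nat.lt_succ_iff.1 (Finset.mem_range.1 hi)))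
  have hprod : ∀ j, Integrable (∏ i ∈ Finset.range (j + 1), Y i) P := fun j => by
    induction j with
    | zero => simpa using hint 0
    | succ j ih =>
      rw [Finset.prod_range_succ]
      exact (hind.indepFun_prod_range_succ (fun i => (hY i).measurable) (j + 1)).integrable_mul
        ih (hint _)
  refine martingale_nat hadp hprod fun j => ?_
  have hpull := condExp_mul_of_stronglyMeasurable_left (hadp j)
    (by simpa only [Finset.prod_range_succ _ (j + 1)] using hprod (j + 1)) (hint (j + 1))
  have hcond := hind.condExp_natural_ae_eq_of_lt hY j.lt_succ_self
  rw [Finset.prod_range_succ _ (j + 1)]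
  filter_upwards [hpull, hcond] with ω h₁ h₂
  rw [h₁, Pi.mul_apply, h₂, hmean, mul_one]

theorem measureReal_exists_le_prod_range_succ_le {Y : ℕ → Ω → ℝ}
    (hY : ∀ i, StronglyMeasurable (Y i)) (hind : iIndepFun Y P) (hnonneg : ∀ i, 0 ≤ Y i)
    (hint : ∀ i, Integrable (Y i) P) (hmean : ∀ i, ∫ ω, Y i ω ∂P = 1) (N : ℕ) {y : ℝ}
    (hy : 0 < y) :
    P.real {ω | ∃ j ≤ N, y ≤ ∏ i ∈ Finset.range (j + 1), Y i ω} ≤ y⁻¹ := by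
  have := hind.isProbabilityMeasure
  have hM := martingale_prod_range_succ hY hind hint hmean
  set M := fun j => ∏ i ∈ Finset.range (j + 1), Y i with hM_def
  have hM_nonneg : 0 ≤ M := fun j => Finset.prod_nonneg fun i _ => hnonneg i
  have hM_mean : ∫ ω, M N ω ∂P = 1 := by
    simpa [hM_def, hmean] using (hM.setIntegral_eq N.zero_le MeasurableSet.univ).symm
  lift y to NNReal using hy.le
  have hdoob := maximal_ineq hM.submartingale hM_nonneg (ε := y) N
  have hevent : {ω | (y : ℝ) ≤
      (Finset.range (N + 1)).sup' Finset.nonempty_range_add_one fun j => M j ω} =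
      {ω | ∃ j ≤ N, (y : ℝ) ≤ ∏ i ∈ Finset.range (j + 1), Y i ω} := by
    ext ω
    simp [hM_def, Finset.le_sup'_iff]
  rw [hevent] at hdoob
  have hle : (y : ENNReal) * P {ω | ∃ j ≤ N, (y : ℝ) ≤ ∏ i ∈ Finset.range (j + 1), Y i ω} ≤ 1 := by
    refine hdoob.trans (ENNReal.ofReal_le_one.2 ?_)
    rw [← hM_mean]
    exact setIntegral_le_integral (hM.integrable N) (Filter.Eventually.of_forall (hM_nonneg N))
  rw [inv_eq_one_div, le_div_iff₀' hy]
  simpa [measureReal_def] using ENNReal.toReal_mono ENNReal.one_ne_top hle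

theorem measureReal_exists_le_mul_sum_range_succ_sub_le {X : ℕ → Ω → ℝ} {c : NNReal}
    (hX : ∀ i, Measurable (X i)) (hind : iIndepFun X P) (hsub : ∀ i, HasSubgaussianMGF (X i) c P)
    (N : ℕ) (a y : ℝ) :
    P.real {ω | ∃ j ≤ N,
      y ≤ a * ∑ i ∈ Finset.range (j + 1), X i ω - (j + 1) * (c * a ^ 2 / 2)} ≤ Real.exp (-y) := by
  have := hind.isProbabilityMeasure
  have mgf_pos' : ∀ i, 0 < mgf (X i) P a := fun i => mgf_pos ((hsub i).integrable_exp_mul a)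
  set Y : ℕ → Ω → ℝ := fun i ω => Real.exp (a * X i ω) / mgf (X i) P a with hY
  have hY_meas : ∀ i, Measurable (Y i) := fun i => by simp only [hY]; fun_prop
  have hville := measureReal_exists_le_prod_range_succ_le (fun i => (hY_meas i).stronglyMeasurable)
    (hind.comp (fun i x => Real.exp (a * x) / mgf (X i) P a) fun i => by fun_prop)
    (fun i ω => (div_pos (Real.exp_pos _) (mgf_pos' i)).le)
    (fun i => ((hsub i).integrable_exp_mul a).div_const _)
    (fun i => (integral_div _ _).trans (div_self (mgf_pos' i).ne')) N (Real.exp_pos y)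
  rw [Real.exp_neg]
  refine (measureReal_mono ?_).trans hville
  rintro ω ⟨j, hj, hy⟩
  refine ⟨j, hj, ?_⟩
  calc Real.exp y
      ≤ Real.exp (a * ∑ i ∈ Finset.range (j + 1), X i ω - (j + 1) * (c * a ^ 2 / 2)) :=
        Real.exp_le_exp.2 hy
    _ = ∏ i ∈ Finset.range (j + 1), Real.exp (a * X i ω) / Real.exp (c * a ^ 2 / 2) := by
        simp [Finset.prod_div_distrib, Real.exp_sub, Finset.mul_sum, Real.exp_sum,
          ← Real.exp_nat_mul]
    _ ≤ ∏ i ∈ Finset.range (j + 1), Y i ω :=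
        Finset.prod_le_prod (fun i _ => by positivity) fun i _ =>
          div_le_div_of_nonneg_left (Real.exp_pos _).le (mgf_pos' i) ((hsub i).mgf_le a)

theorem measureReal_exists_mul_lt_abs_sum_range_le {X : ℕ → Ω → ℝ} {c : NNReal}
    (hX : ∀ i, Measurable (X i)) (hind : iIndepFun X P) (hsub : ∀ i, HasSubgaussianMGF (X i) c P)
    (N : ℕ) {r : ℝ} (hr : 0 ≤ r) (d : ℝ) :
    P.real {ω | ∃ j ≤ N, d ≤ j ∧ c * r * j < |∑ i ∈ Finset.range j, X i ω|} ≤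
      2 * Real.exp (-(c * r ^ 2 * d / 2)) := by
  have := hind.isProbabilityMeasure
  have hside := fun a : ℝ => measureReal_exists_le_mul_sum_range_succ_sub_le hX hind hsub N a
    (c * r ^ 2 * d / 2)
  rw [two_mul]
  refine ((measureReal_mono ?_).trans (measureReal_union_le _ _)).trans
    (add_le_add (hside r) (hside (-r)))
  rintro ω ⟨j, hj, hd, habs⟩
  obtain _ | j := j
  · simp at habs
  have hcd : c * r ^ 2 * d ≤ c * r ^ 2 * (j + 1) := by
    push_cast at hd
    gcongr
  refine (lt_abs.1 habs).imp (fun h => ⟨j, by lia, ?_⟩) fun h => ⟨j, by lia, ?_⟩ <;>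
  · push_cast at h
    nlinarith [mul_le_mul_of_nonneg_left h.le hr]

end SubgaussianWalk

section PrefixSum

variable {n : ℕ}

/-- The sum of the entries of `v` at times before `t`, for an arbitrary integer time `t`. The data
enter the argument only through the increments of this function. -/
noncomputable def prefixSum (v : Fin n → ℝ) (t : ℤ) : ℝ :=
  ∑ i : Fin n, if (i : ℤ) + 1 < t then v i else 0

theorem prefixSum_of_le_one (v : Fin n → ℝ) {t : ℤ} (ht : t ≤ 1) : prefixSum v t = 0 :=
  Finset.sum_eq_zero fun i _ => if_neg (by lia)

theorem prefixSum_of_lt (v : Fin n → ℝ) {t : ℤ} (ht : n < t) : prefixSum v t = ∑ i, v i :=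
  Finset.sum_congr rfl fun i _ => if_pos (by have := i.isLt; lia)

theorem prefixSum_add (v w : Fin n → ℝ) (t : ℤ) :
    prefixSum (fun i => v i + w i) t = prefixSum v t + prefixSum w t := by
  simp only [prefixSum, ← Finset.sum_add_distrib]
  exact Finset.sum_congr rfl fun i _ => by split_ifs <;> simp

theorem segmentSum_eq_prefixSum_sub (v : Fin n → ℝ) {a b : ℕ} (h : a ≤ b) :
    segmentSum v a b = prefixSum v b - prefixSum v a := by
  simp only [segmentSum, prefixSum, ← Finset.sum_sub_distrib]
  refine Finset.sum_congr rfl fun i _ => ?_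
  have hseg : InSegment a b i ↔ ¬ (i : ℤ) + 1 < a ∧ (i : ℤ) + 1 < b := by
    rw [InSegment]
    lia
  by_cases hb : (i : ℤ) + 1 < b
  · by_cases ha : (i : ℤ) + 1 < a <;> simp [hseg, ha, hb]
  · have ha : ¬ (i : ℤ) + 1 < a := by lia
    simp [hseg, ha, hb]

theorem segmentSum_congr {v w : Fin n → ℝ} {a b : ℕ} (h : ∀ i, InSegment a b i → v i = w i) :
    segmentSum v a b = segmentSum w a b :=
  Finset.sum_congr rfl fun i _ => by split_ifs with hi; exacts [h i hi, rfl]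

theorem segmentSum_sub (v w : Fin n → ℝ) (a b : ℕ) :
    segmentSum (fun i => v i - w i) a b = segmentSum v a b - segmentSum w a b := by
  simp only [segmentSum, ← Finset.sum_sub_distrib]
  exact Finset.sum_congr rfl fun i _ => by split_ifs <;> simp

theorem segmentSum_mul_const (v : Fin n → ℝ) (c : ℝ) (a b : ℕ) :
    segmentSum (fun i => v i * c) a b = segmentSum v a b * c := by
  simp only [segmentSum, Finset.sum_mul, ite_mul, zero_mul]

theorem segmentSum_const (c : ℝ) {a b : ℕ} (ha : 1 ≤ a) (hab : a ≤ b) (hb : b ≤ n + 1) :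
    segmentSum (fun _ : Fin n => c) a b = c * ((b : ℝ) - a) := by
  have hIco : (Finset.range n).filter (fun i => a ≤ i + 1 ∧ i + 1 < b) =
      Finset.Ico (a - 1) (b - 1) := by
    ext i
    simp only [Finset.mem_filter, Finset.mem_range, Finset.mem_Ico]
    lia
  calc segmentSum (fun _ : Fin n => c) a b
      = ∑ i ∈ Finset.range n, if a ≤ i + 1 ∧ i + 1 < b then c else 0 :=
        Fin.sum_univ_eq_sum_range (fun i => if a ≤ i + 1 ∧ i + 1 < b then c else 0) n
    _ = (b - 1 - (a - 1) : ℕ) * c := by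
        rw [← Finset.sum_filter, hIco, Finset.sum_const, Nat.card_Ico, nsmul_eq_mul]
    _ = c * ((b : ℝ) - a) := by
        rw [show b - 1 - (a - 1) = b - a by lia, Nat.cast_sub hab, mul_comm]

theorem prefixSum_add_one_sub {Ω : Type*} (ε : Fin n → Ω → ℝ) (t : ℤ) (ω : Ω) :
    prefixSum (fun i => ε i ω) (t + 1) - prefixSum (fun i => ε i ω) t =
      Function.extend (fun i : Fin n => (i : ℤ) + 1) ε (fun _ _ => 0) t ω := by
  have hinj : (fun i : Fin n => (i : ℤ) + 1).Injective := fun i j h => by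
    exact Fin.ext (by simpa using h)
  simp only [prefixSum, ← Finset.sum_sub_distrib]
  by_cases ht : ∃ i : Fin n, (i : ℤ) + 1 = t
  · obtain ⟨i, rfl⟩ := ht
    rw [hinj.extend_apply ε _ i, Finset.sum_eq_single i]
    · simp
    · intro j _ hj
      have : (j : ℤ) ≠ i := fun h => hj (Fin.ext (by exact_mod_cast h))
      split_ifs <;> first | lia | simp
    · simp
  · rw [Function.extend_apply' _ _ _ ht]
    refine Finset.sum_eq_zero fun j _ => ?_
    have : (j : ℤ) + 1 ≠ t := fun h => ht ⟨j, h⟩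
    split_ifs <;> first | lia | simp

/-- The mean of the increments over `[a, b)` of the prefix sum `F`. -/
noncomputable def incrementMean (F : ℤ → ℝ) (a b : ℤ) : ℝ :=
  (F b - F a) / ((b : ℝ) - a)

theorem mul_lt_abs_sub_of_lt_abs_incrementMean {F : ℤ → ℝ} {r : ℝ} {a b : ℤ} (hab : a < b)
    (h : r < |incrementMean F a b|) : r * (b - a) < |F b - F a| := by
  have hlen : (0 : ℝ) < b - a := sub_pos.2 (by exact_mod_cast hab)
  rwa [incrementMean, abs_div, abs_of_pos hlen, lt_div_iff₀ hlen] at h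

end PrefixSum

namespace IsNoise

variable {Ω : Type*} [MeasurableSpace Ω] {P : Measure Ω} {n : ℕ} {ε : Fin n → Ω → ℝ}

theorem measureReal_exists_mul_lt_abs_sum_le (h : IsNoise P ε) {g : ℕ → ℤ} (hg : g.Injective)
    (N : ℕ) {r : ℝ} (hr : 0 ≤ r) (d : ℝ) :
    P.real {ω | ∃ j ≤ N, d ≤ j ∧ r * j < |∑ i ∈ Finset.range j,
      (prefixSum (fun i => ε i ω) (g i + 1) - prefixSum (fun i => ε i ω) (g i))|} ≤
      2 * Real.exp (-(r ^ 2 * d / 2)) := by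
  have := h.indep.isProbabilityMeasure
  set ξ : ℤ → Ω → ℝ := Function.extend (fun i : Fin n => (i : ℤ) + 1) ε fun _ _ => 0
  have hinj : (fun i : Fin n => (i : ℤ) + 1).Injective := fun i j hij => by
    exact Fin.ext (by simpa using hij)
  have hξ : ∀ t, (∃ i, ξ t = ε i) ∨ ξ t = fun _ => 0 := fun t => by
    by_cases ht : ∃ i : Fin n, (i : ℤ) + 1 = t
    · obtain ⟨i, rfl⟩ := ht
      exact Or.inl ⟨i, hinj.extend_apply ε _ i⟩
    · exact Or.inr (Function.extend_apply' _ _ _ ht)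
  have hmeas : ∀ t, Measurable (ξ t) := fun t => by
    obtain ⟨i, hi⟩ | hi := hξ t
    · exact hi ▸ h.measurable i
    · exact hi ▸ measurable_const
  have hsub : ∀ t, HasSubgaussianMGF (ξ t) 1 P := fun t => by
    obtain ⟨i, hi⟩ | hi := hξ t
    · exact hi ▸ h.subgaussian i
    · exact hi ▸ ⟨fun s => by simp, fun s => by
        simp only [mgf_const', probReal_univ, mul_zero, Real.exp_zero, mul_one, NNReal.coe_one,
          one_mul, Real.one_le_exp_iff]
        positivity⟩
  simp only [prefixSum_add_one_sub]
  simpa using measureReal_exists_mul_lt_abs_sum_range_le (fun i => hmeas (g i))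
    ((iIndepFun_extend_const h.indep hinj 0).precomp hg) (fun i => hsub (g i)) N hr d

theorem measureReal_exists_right_le (h : IsNoise P ε) (T : ℤ) {r d : ℝ} (hr : 0 ≤ r)
    (hd : 0 < d) :
    P.real {ω | ∃ a : ℤ, a ≤ n + 1 ∧ d ≤ (a : ℝ) - T ∧
      r < |incrementMean (prefixSum fun i => ε i ω) T a|} ≤ 2 * Real.exp (-(r ^ 2 * d / 2)) := by
  have := h.indep.isProbabilityMeasure
  refine (measureReal_mono ?_).trans
    (h.measureReal_exists_mul_lt_abs_sum_le (g := fun i => T + i)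
      (fun i j hij => by simpa using hij) (n + 1 - T).toNat hr d)
  rintro ω ⟨a, han, hda, hlt⟩
  have hTa : T < a := by exact_mod_cast sub_pos.1 (hd.trans_le hda)
  replace hlt := mul_lt_abs_sub_of_lt_abs_incrementMean hTa hlt
  obtain ⟨j, rfl⟩ := Int.le.dest hTa.le
  refine ⟨j, by lia, by simpa using hda, ?_⟩
  have hsum := Finset.sum_range_sub (fun i : ℕ => prefixSum (fun k => ε k ω) (T + i)) j
  simp only [Nat.cast_add, Nat.cast_one, ← add_assoc] at hsum
  rw [hsum]
  simpa using hlt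

theorem measureReal_exists_left_le (h : IsNoise P ε) (T : ℤ) {r d : ℝ} (hr : 0 ≤ r)
    (hd : 0 < d) :
    P.real {ω | ∃ a : ℤ, 1 ≤ a ∧ d ≤ (T : ℝ) - a ∧
      r < |incrementMean (prefixSum fun i => ε i ω) a T|} ≤ 2 * Real.exp (-(r ^ 2 * d / 2)) := by
  have := h.indep.isProbabilityMeasure
  refine (measureReal_mono ?_).trans
    (h.measureReal_exists_mul_lt_abs_sum_le (g := fun i => T - (i + 1))
      (fun i j hij => by simpa using hij) (T - 1).toNat hr d)
  rintro ω ⟨a, ha, hda, hlt⟩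
  have haT : a < T := by exact_mod_cast sub_pos.1 (hd.trans_le hda)
  replace hlt := mul_lt_abs_sub_of_lt_abs_incrementMean haT hlt
  obtain ⟨j, hj⟩ := Int.le.dest haT.le
  obtain rfl : a = T - j := by lia
  refine ⟨j, by lia, by simpa using hda, ?_⟩
  have hsum := Finset.sum_range_sub' (fun i : ℕ => prefixSum (fun k => ε k ω) (T - i)) j
  simp only [Nat.cast_add, Nat.cast_one, Nat.cast_zero, sub_zero] at hsum
  have hstep : ∀ i : ℕ, T - ((i : ℤ) + 1) + 1 = T - i := fun i => by ring
  simp only [hstep, hsum]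
  simpa using hlt

end IsNoise

section PathCost

variable {α β M : Type*} [AddCommMonoid M]

/-- The sum of `G` over the consecutive pairs of a list. The penalized least-squares criterion is
of this form, which makes it local in the change-point vector. -/
def pathCost (G : α → α → M) : List α → M
  | [] => 0
  | [_] => 0
  | a :: b :: l => G a b + pathCost G (b :: l)

@[simp] theorem pathCost_nil (G : α → α → M) : pathCost G [] = 0 := rfl

@[simp] theorem pathCost_singleton (G : α → α → M) (a : α) : pathCost G [a] = 0 := rfl

@[simp] theorem pathCost_cons_cons (G : α → α → M) (a b : α) (l : List α) :
    pathCost G (a :: b :: l) = G a b + pathCost G (b :: l) := rfl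

theorem pathCost_append_cons (G : α → α → M) (l₁ : List α) (a : α) (l₂ : List α) :
    pathCost G (l₁ ++ a :: l₂) = pathCost G (l₁ ++ [a]) + pathCost G (a :: l₂) := by
  induction l₁ with
  | nil => simp
  | cons x l ih =>
    cases l with
    | nil => simp
    | cons y l =>
      simp only [List.cons_append, pathCost_cons_cons] at ih ⊢
      rw [ih, add_assoc]

theorem pathCost_map (G : β → β → M) (f : α → β) (l : List α) :
    pathCost G (l.map f) = pathCost (fun a b => G (f a) (f b)) l := by
  induction l with
  | nil => simp
  | cons x l ih => cases l <;> simp_all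

theorem pathCost_reverse (G : α → α → M) (l : List α) :
    pathCost G l.reverse = pathCost (fun a b => G b a) l := by
  induction l with
  | nil => simp
  | cons x l ih =>
    cases l with
    | nil => simp
    | cons y l =>
      rw [List.reverse_cons, List.reverse_cons, List.append_assoc, List.singleton_append,
        pathCost_append_cons, ← List.reverse_cons, ih]
      simp [add_comm]

theorem pathCost_ofFn (G : α → α → M) {k : ℕ} (f : Fin (k + 1) → α) :
    pathCost G (List.ofFn f) = ∑ i : Fin k, G (f i.castSucc) (f i.succ) := by
  induction k with
  | zero => simp [List.ofFn_succ]
  | succ k ih =>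
    have h := ih fun i => f i.succ
    rw [List.ofFn_succ] at h
    rw [List.ofFn_succ, List.ofFn_succ, pathCost_cons_cons, h, Fin.sum_univ_succ]
    simp

end PathCost

namespace ChangePointVector

variable {n : ℕ}

theorem pos_castSucc_lt_succ (τ : ChangePointVector n) (k : Fin (τ.len + 1)) :
    τ.pos k.castSucc < τ.pos k.succ := τ.strictMono Fin.castSucc_lt_succ

theorem one_le_pos (τ : ChangePointVector n) (k : Fin (τ.len + 2)) : 1 ≤ τ.pos k :=
  τ.pos_zero ▸ τ.strictMono.monotone (Fin.zero_le k)

theorem pos_le (τ : ChangePointVector n) (k : Fin (τ.len + 2)) : τ.pos k ≤ n + 1 :=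
  τ.pos_last ▸ τ.strictMono.monotone (Fin.le_last k)

theorem segment_unique (τ : ChangePointVector n) {k k' : Fin (τ.len + 1)} {i : Fin n}
    (h : InSegment (τ.pos k.castSucc) (τ.pos k.succ) i)
    (h' : InSegment (τ.pos k'.castSucc) (τ.pos k'.succ) i) : k = k' := by
  wlog hlt : k < k' generalizing k k'
  · obtain rfl | hlt' := (not_lt.1 hlt).eq_or_lt
    exacts [rfl, (this h' h hlt').symm]
  · have hle : τ.pos k.succ ≤ τ.pos k'.castSucc :=
      τ.strictMono.monotone (Fin.succ_le_castSucc_iff.2 hlt)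
    exact absurd (h.2.trans_le hle) (not_lt.2 h'.1)

theorem sum_ite_segment (τ : ChangePointVector n) (f : Fin (τ.len + 1) → ℝ) {i : Fin n}
    {k : Fin (τ.len + 1)} (h : InSegment (τ.pos k.castSucc) (τ.pos k.succ) i) :
    (∑ k : Fin (τ.len + 1), if InSegment (τ.pos k.castSucc) (τ.pos k.succ) i then f k else 0) =
      f k := by
  rw [Finset.sum_eq_single k, if_pos h]
  · exact fun k' _ hne => if_neg fun h' => hne (τ.segment_unique h' h)
  · exact fun hk => absurd (Finset.mem_univ k) hk

theorem sum_segmentSum (τ : ChangePointVector n) (v : Fin n → ℝ) :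
    ∑ k : Fin (τ.len + 1), segmentSum v (τ.pos k.castSucc) (τ.pos k.succ) = ∑ i, v i := by
  have htelescope : ∑ k : Fin (τ.len + 1),
      (prefixSum v (τ.pos k.succ) - prefixSum v (τ.pos k.castSucc)) =
      prefixSum v (τ.pos (Fin.last _)) - prefixSum v (τ.pos 0) := by
    have hsucc := Fin.sum_univ_succ fun k => prefixSum v (τ.pos k)
    have hcastSucc := Fin.sum_univ_castSucc fun k => prefixSum v (τ.pos k)
    rw [Finset.sum_sub_distrib]
    linarith
  have hfirst : prefixSum v (τ.pos 0) = 0 := prefixSum_of_le_one v (by simp [τ.pos_zero])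
  have hlast : prefixSum v (τ.pos (Fin.last _)) = ∑ i, v i :=
    prefixSum_of_lt v (by simp [τ.pos_last])
  simp_rw [segmentSum_eq_prefixSum_sub v (τ.pos_castSucc_lt_succ _).le, htelescope, hfirst, hlast,
    sub_zero]

/-- The vector of segment means of `Y`, that is the orthogonal projection `Π_τ Y`. -/
noncomputable def segmentMean (τ : ChangePointVector n) (Y : Fin n → ℝ) (i : Fin n) : ℝ :=
  ∑ k : Fin (τ.len + 1), if InSegment (τ.pos k.castSucc) (τ.pos k.succ) i then
    segmentSum Y (τ.pos k.castSucc) (τ.pos k.succ) /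
      ((τ.pos k.succ : ℝ) - τ.pos k.castSucc) else 0

theorem segmentMean_eq (τ : ChangePointVector n) (Y : Fin n → ℝ) {k : Fin (τ.len + 1)} {i : Fin n}
    (h : InSegment (τ.pos k.castSucc) (τ.pos k.succ) i) :
    τ.segmentMean Y i = segmentSum Y (τ.pos k.castSucc) (τ.pos k.succ) /
      ((τ.pos k.succ : ℝ) - τ.pos k.castSucc) :=
  τ.sum_ite_segment _ h

theorem pos_succ_sub_castSucc_pos (τ : ChangePointVector n) (k : Fin (τ.len + 1)) :
    (0 : ℝ) < τ.pos k.succ - τ.pos k.castSucc :=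
  sub_pos.2 (by exact_mod_cast τ.pos_castSucc_lt_succ k)

theorem segmentSum_segmentMean (τ : ChangePointVector n) (Y : Fin n → ℝ) (k : Fin (τ.len + 1)) :
    segmentSum (τ.segmentMean Y) (τ.pos k.castSucc) (τ.pos k.succ) =
      segmentSum Y (τ.pos k.castSucc) (τ.pos k.succ) := by
  rw [segmentSum_congr fun i hi => τ.segmentMean_eq Y hi, segmentSum_const _ (τ.one_le_pos _)
    (τ.pos_castSucc_lt_succ k).le (τ.pos_le _),
    div_mul_cancel₀ _ (τ.pos_succ_sub_castSucc_pos k).ne']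

theorem sum_sub_segmentMean_mul (τ : ChangePointVector n) (Y : Fin n → ℝ)
    {w : EuclideanSpace ℝ (Fin n)} (hw : w ∈ piecewiseConstant τ) :
    ∑ i, (Y i - τ.segmentMean Y i) * w i = 0 := by
  rw [← τ.sum_segmentSum]
  refine Finset.sum_eq_zero fun k _ => ?_
  have hlt := τ.pos_castSucc_lt_succ k
  have hfirst : 1 ≤ τ.pos k.castSucc := τ.one_le_pos _
  let i₀ : Fin n := ⟨τ.pos k.castSucc - 1, by have := τ.pos_le k.succ; lia⟩
  have hi₀ : InSegment (τ.pos k.castSucc) (τ.pos k.succ) i₀ := by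
    constructor <;> dsimp only [i₀] <;> lia
  rw [segmentSum_congr (w := fun i => (Y i - τ.segmentMean Y i) * w i₀)
      fun i hi => by rw [hw k i i₀ hi hi₀],
    segmentSum_mul_const, segmentSum_sub, segmentSum_segmentMean, sub_self, zero_mul]

theorem segmentMean_mem (τ : ChangePointVector n) (Y : Fin n → ℝ) :
    WithLp.toLp 2 (τ.segmentMean Y) ∈ piecewiseConstant τ := fun _ _ _ hi hj =>
  (τ.segmentMean_eq Y hi).trans (τ.segmentMean_eq Y hj).symm

theorem starProjection_eq (τ : ChangePointVector n) (Y : Fin n → ℝ) :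
    (piecewiseConstant τ).starProjection (WithLp.toLp 2 Y) = WithLp.toLp 2 (τ.segmentMean Y) := by
  refine Submodule.eq_starProjection_of_mem_of_inner_eq_zero (τ.segmentMean_mem Y) fun w hw => ?_
  rw [← τ.sum_sub_segmentMean_mul Y hw, PiLp.inner_apply]
  exact Finset.sum_congr rfl fun i _ => by simp [mul_comm]

theorem norm_sub_starProjection_sq (τ : ChangePointVector n) (Y : Fin n → ℝ) :
    ‖WithLp.toLp 2 Y - (piecewiseConstant τ).starProjection (WithLp.toLp 2 Y)‖ ^ 2 =
      ∑ i, Y i ^ 2 - ∑ k : Fin (τ.len + 1),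
        segmentSum Y (τ.pos k.castSucc) (τ.pos k.succ) ^ 2 /
          ((τ.pos k.succ : ℝ) - τ.pos k.castSucc) := by
  have hnorm : ‖WithLp.toLp 2 Y - WithLp.toLp 2 (τ.segmentMean Y)‖ ^ 2 =
      ∑ i, Y i * (Y i - τ.segmentMean Y i) := by
    have horth := τ.sum_sub_segmentMean_mul Y (τ.segmentMean_mem Y)
    rw [EuclideanSpace.norm_sq_eq, ← sub_zero (∑ i, Y i * _), ← horth, ← Finset.sum_sub_distrib]
    refine Finset.sum_congr rfl fun i _ => ?_
    simp only [PiLp.sub_apply, Real.norm_eq_abs, sq_abs]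
    ring
  have hsegment : ∀ k : Fin (τ.len + 1),
      segmentSum (fun i => Y i * τ.segmentMean Y i) (τ.pos k.castSucc) (τ.pos k.succ) =
        segmentSum Y (τ.pos k.castSucc) (τ.pos k.succ) ^ 2 /
          ((τ.pos k.succ : ℝ) - τ.pos k.castSucc) := fun k => by
    rw [segmentSum_congr fun i hi => by rw [τ.segmentMean_eq Y hi], segmentSum_mul_const]
    ring
  rw [starProjection_eq, hnorm]
  simp_rw [← hsegment, τ.sum_segmentSum, ← Finset.sum_sub_distrib]
  exact Finset.sum_congr rfl fun i _ => by ring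

/-- The increasing list of all positions, end points included, as integers. Integers rather than
natural numbers make the time reversal `t ↦ -t` available. -/
def toList (τ : ChangePointVector n) : List ℤ := List.ofFn fun i => (τ.pos i : ℤ)

theorem sortedLT_toList (τ : ChangePointVector n) : τ.toList.SortedLT :=
  List.sortedLT_ofFn_iff.2 (Nat.strictMono_cast.comp τ.strictMono)

theorem head?_toList (τ : ChangePointVector n) : τ.toList.head? = some 1 := by
  rw [toList, List.ofFn_succ]
  simp [τ.pos_zero]

theorem getLast?_toList (τ : ChangePointVector n) : τ.toList.getLast? = some (n + 1 : ℤ) := by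
  rw [toList, List.ofFn_succ', List.concat_eq_append, List.getLast?_append]
  simp [τ.pos_last]

theorem exists_toList_eq_ofFn {k : ℕ} {f : Fin (k + 2) → ℤ} (hf : StrictMono f) (hzero : f 0 = 1)
    (hlast : f (Fin.last (k + 1)) = n + 1) : ∃ τ : ChangePointVector n, τ.toList = List.ofFn f := by
  have hpos : ∀ i, 1 ≤ f i := fun i => hzero ▸ hf.monotone (Fin.zero_le i)
  refine ⟨⟨k, fun i => (f i).toNat, fun i j hij => ?_, by simp [hzero], by rw [hlast]; lia⟩, ?_⟩
  · have := hf hij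
    have := hpos i
    simp only
    lia
  · exact congrArg List.ofFn (funext fun i => Int.toNat_of_nonneg (by have := hpos i; lia))

theorem exists_toList_eq {l : List ℤ} (hsorted : l.SortedLT) (hhead : l.head? = some 1)
    (hlast : l.getLast? = some (n + 1 : ℤ)) (hlen : 2 ≤ l.length) :
    ∃ τ : ChangePointVector n, τ.toList = l := by
  obtain ⟨k, hk⟩ := Nat.exists_eq_add_of_le' hlen
  have hget : List.ofFn (fun i : Fin (k + 2) => l.get (i.cast hk.symm)) = l :=
    List.ext_getElem (by simp [hk]) fun i _ _ => List.getElem_ofFn _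
  rw [← hget]
  refine exists_toList_eq_ofFn (hsorted.strictMono_get.comp (Fin.cast_strictMono _)) ?_ ?_
  · rw [List.head?_eq_getElem?] at hhead
    exact (List.getElem?_eq_some_iff.1 hhead).2
  · rw [List.getLast?_eq_getElem?] at hlast
    obtain ⟨_, hval⟩ := List.getElem?_eq_some_iff.1 hlast
    simp only [hk] at hval
    exact hval

end ChangePointVector

section LocalOptimality

/-- The penalty of a segment of length `u`. -/
noncomputable def scalePenalty (n q u : ℝ) : ℝ :=
  2 * Real.log (n / u) + q

/-- The contribution of the segment `[a, b)` to the criterion, up to terms that do not depend on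
the change-point vector. Here `F` is the prefix sum of the data. -/
noncomputable def segCost (F : ℤ → ℝ) (n L q : ℝ) (a b : ℤ) : ℝ :=
  -((F b - F a) ^ 2 / ((b : ℝ) - a)) + L * scalePenalty n q ((b : ℝ) - a)

theorem criterion_eq_pathCost {n : ℕ} (L q : ℝ) (Y : Fin n → ℝ) (τ : ChangePointVector n) :
    criterion L q Y τ = ∑ i, Y i ^ 2 - L * q +
      pathCost (segCost (prefixSum Y) n L q) τ.toList := by
  rw [criterion, τ.norm_sub_starProjection_sq, ChangePointVector.toList, pathCost_ofFn, penalty]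
  simp only [segCost, scalePenalty, Int.cast_natCast,
    segmentSum_eq_prefixSum_sub Y (τ.pos_castSucc_lt_succ _).le, Finset.sum_add_distrib,
    Finset.sum_neg_distrib, ← Finset.mul_sum, Finset.sum_const, Finset.card_univ, Fintype.card_fin,
    nsmul_eq_mul, Nat.cast_add, Nat.cast_one]
  ring

/-- No replacement of a stretch of the increasing list `l` between two of its entries lowers its
path cost. Every penalized least-squares estimator has this property, and it is all that the
argument uses about the estimator. -/
structure IsLocallyOptimal {α : Type*} [Preorder α] (G : α → α → ℝ) (l : List α) : Prop where
  sorted : l.Pairwise (· < ·)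
  le : ∀ (l₁ : List α) (a : α) (s : List α) (c : α) (l₂ s' : List α),
    l = l₁ ++ a :: (s ++ c :: l₂) → (a :: (s' ++ [c])).Pairwise (· < ·) →
      pathCost G (a :: (s ++ [c])) ≤ pathCost G (a :: (s' ++ [c]))

theorem IsLocallyOptimal.reflect {α : Type*} [AddCommGroup α] [PartialOrder α]
    [IsOrderedAddMonoid α] {G : α → α → ℝ} {l : List α} (h : IsLocallyOptimal G l) :
    IsLocallyOptimal (fun a b => G (-b) (-a)) (l.map Neg.neg).reverse := by
  have hsorted : ∀ {s : List α}, s.Pairwise (· < ·) → (s.map Neg.neg).reverse.Pairwise (· < ·) :=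
    fun hs => by simpa [List.pairwise_reverse, List.pairwise_map] using hs
  have hcost : ∀ s : List α, pathCost (fun a b => G (-b) (-a)) s =
      pathCost G (s.map Neg.neg).reverse := fun s => by rw [pathCost_reverse, pathCost_map]
  refine ⟨hsorted h.sorted, fun l₁ a s c l₂ s' hl hs' => ?_⟩
  have hle := h.le (l₂.map Neg.neg).reverse (-c) (s.map Neg.neg).reverse (-a)
    (l₁.map Neg.neg).reverse (s'.map Neg.neg).reverse
    (by simpa [List.map_reverse] using congrArg (fun l => (l.map Neg.neg).reverse) hl)
    (by simpa using hsorted hs')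
  simpa [hcost] using hle

theorem pairwise_replace_stretch {α : Type*} {R : α → α → Prop} [IsTrans α R]
    {l₁ s s' l₂ : List α} {a c : α} (h : (l₁ ++ a :: (s ++ c :: l₂)).Pairwise R)
    (hs' : (a :: (s' ++ [c])).Pairwise R) : (l₁ ++ a :: (s' ++ c :: l₂)).Pairwise R := by
  have hac : R a c := List.rel_of_pairwise_cons hs' (by simp)
  have htrans := fun {x y z : α} (hxy : R x y) (hyz : R y z) => _root_.trans hxy hyz
  simp only [List.pairwise_append, List.pairwise_cons, List.mem_cons, List.mem_append,
    List.not_mem_nil, or_false, forall_eq, or_imp, forall_and] at h hs' ⊢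
  grind

theorem IsPenalizedLeastSquares.isLocallyOptimal {n : ℕ} {L q : ℝ} {Y : Fin n → ℝ}
    {τ : ChangePointVector n} (h : IsPenalizedLeastSquares L q Y τ) :
    IsLocallyOptimal (segCost (prefixSum Y) n L q) τ.toList := by
  refine ⟨τ.sortedLT_toList.pairwise, fun l₁ a s c l₂ s' hl hs' => ?_⟩
  have hsplit : ∀ r : List ℤ, pathCost (segCost (prefixSum Y) n L q) (l₁ ++ a :: (r ++ c :: l₂)) =
      pathCost (segCost (prefixSum Y) n L q) (l₁ ++ [a]) +
        (pathCost (segCost (prefixSum Y) n L q) (a :: (r ++ [c])) +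
          pathCost (segCost (prefixSum Y) n L q) (c :: l₂)) := fun r => by
    rw [pathCost_append_cons _ l₁, ← List.cons_append, pathCost_append_cons _ (a :: r),
      List.cons_append]
  have hhead := τ.head?_toList
  have hlast := τ.getLast?_toList
  have hsorted := τ.sortedLT_toList.pairwise
  rw [hl] at hhead hlast hsorted
  obtain ⟨τ', hτ'⟩ := ChangePointVector.exists_toList_eq
    (pairwise_replace_stretch hsorted hs').sortedLT (by rw [← hhead]; cases l₁ <;> simp)
    (by rw [← hlast]; simp [List.getLast?_append, List.getLast?_cons])
    (by simp only [List.length_append, List.length_cons]; lia)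
  have hle := h τ'
  rw [criterion_eq_pathCost, criterion_eq_pathCost, hτ', hl, hsplit, hsplit] at hle
  linarith

end LocalOptimality

section Triads

variable {n L u v : ℝ} {a b c : ℤ}

theorem le_scalePenalty (q : ℝ) (hu : 0 < u) (hun : u ≤ n) : q ≤ scalePenalty n q u := by
  have := Real.log_nonneg ((one_le_div hu).2 hun)
  rw [scalePenalty]
  linarith

theorem scalePenalty_eq_add_log (q : ℝ) (hn : n ≠ 0) (hu : u ≠ 0) (hv : v ≠ 0) :
    scalePenalty n q u = scalePenalty n q v + 2 * Real.log (v / u) := by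
  rw [scalePenalty, scalePenalty, Real.log_div hn hu, Real.log_div hn hv, Real.log_div hv hu]
  ring

theorem scalePenalty_anti (q : ℝ) (hn : 0 < n) (hu : 0 < u) (huv : u ≤ v) :
    scalePenalty n q v ≤ scalePenalty n q u := by
  rw [scalePenalty_eq_add_log q hn.ne' hu.ne' (hu.trans_le huv).ne']
  linarith [Real.log_nonneg ((one_le_div hu).2 huv)]

theorem scalePenalty_le_add (q : ℝ) (hn : n ≠ 0) (hu : 0 < u) (hv : 0 < v) :
    scalePenalty n q u ≤ scalePenalty n q v + 2 * ((v - u) / u) := by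
  rw [scalePenalty_eq_add_log q hn hu.ne' hv.ne', sub_div, div_self hu.ne']
  linarith [Real.log_le_sub_one_of_pos (div_pos hv hu)]

theorem scalePenalty_le_add_two (q : ℝ) (hn : n ≠ 0) (hu : 0 < u) (hv : 0 < v) (hvu : v ≤ 2 * u) :
    scalePenalty n q u ≤ scalePenalty n q v + 2 := by
  have : (v - u) / u ≤ 1 := (div_le_one hu).2 (by linarith)
  linarith [scalePenalty_le_add q hn hu hv]

/-- Half of the harmonic mean of the lengths of `[a, b)` and `[b, c)`. The squared CUSUM statistic
is the squared jump of the means times this length, and `ψ_q²` is the penalty of this length. -/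
noncomputable def harmonicLength (a b c : ℤ) : ℝ :=
  ((b : ℝ) - a) * ((c : ℝ) - b) / ((c : ℝ) - a)

theorem harmonicLength_neg (a b c : ℤ) :
    harmonicLength (-c) (-b) (-a) = harmonicLength a b c := by
  simp only [harmonicLength]
  push_cast
  ring

theorem harmonicLength_pos (hab : a < b) (hbc : b < c) : 0 < harmonicLength a b c := by
  have hac := hab.trans hbc
  rify at hab hbc hac
  exact div_pos (mul_pos (sub_pos.2 hab) (sub_pos.2 hbc)) (sub_pos.2 hac)

theorem harmonicLength_le_right (hab : a < b) (hbc : b < c) : harmonicLength a b c ≤ c - b := by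
  rify at hab hbc
  rw [harmonicLength, div_le_iff₀ (by linarith)]
  nlinarith

theorem harmonicLength_le_left (hab : a < b) (hbc : b < c) : harmonicLength a b c ≤ b - a := by
  have := harmonicLength_le_right (neg_lt_neg hbc) (neg_lt_neg hab)
  rw [harmonicLength_neg] at this
  push_cast at this
  linarith

theorem half_le_harmonicLength {r : ℝ} (hr : 0 < r) (hab : r ≤ b - a) (hbc : r ≤ c - b) :
    r / 2 ≤ harmonicLength a b c := by
  rw [harmonicLength, div_le_div_iff₀ two_pos (by linarith)]
  nlinarith

theorem scalePenalty_harmonicLength (q : ℝ) (hn : n ≠ 0) (hab : a < b) (hbc : b < c) :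
    scalePenalty n q (harmonicLength a b c) =
      scalePenalty n q (b - a) + scalePenalty n q (c - b) - scalePenalty n q (c - a) := by
  have hca := sub_pos.2 (Int.cast_lt (R := ℝ).2 (hab.trans hbc))
  have hcb := sub_pos.2 (Int.cast_lt (R := ℝ).2 hbc)
  rw [scalePenalty_eq_add_log q hn (harmonicLength_pos hab hbc).ne'
      (sub_pos.2 (Int.cast_lt (R := ℝ).2 hab)).ne',
    scalePenalty_eq_add_log q hn hcb.ne' hca.ne']
  have : ((b : ℝ) - a) / harmonicLength a b c = (c - a) / (c - b) := by
    rify at hab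
    rw [harmonicLength]
    field_simp [(sub_pos.2 hab).ne']
  rw [this]
  ring

theorem scalePenalty_harmonicLength_le (q : ℝ) (hn : n ≠ 0) (hab : a < b) (hbc : b < c) :
    scalePenalty n q (harmonicLength a b c) ≤
      scalePenalty n q (c - b) + 2 * (((c : ℝ) - b) / (b - a)) := by
  rify at hab hbc
  have hle := scalePenalty_le_add q hn (sub_pos.2 hab) (v := c - a) (by linarith)
  rw [sub_sub_sub_cancel_right] at hle
  rw [scalePenalty_harmonicLength q hn (by exact_mod_cast hab) (by exact_mod_cast hbc)]
  linarith

/-- The squared CUSUM statistic of the increments of the prefix sum `F`. -/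
noncomputable def cusumSq (F : ℤ → ℝ) (a b c : ℤ) : ℝ :=
  (incrementMean F b c - incrementMean F a b) ^ 2 * harmonicLength a b c

theorem incrementMean_reflect (F : ℤ → ℝ) (a b : ℤ) :
    incrementMean (fun x => -F (-x)) a b = incrementMean F (-b) (-a) := by
  simp only [incrementMean]
  push_cast
  congr 1 <;> ring

theorem cusumSq_reflect (F : ℤ → ℝ) (a b c : ℤ) :
    cusumSq (fun x => -F (-x)) a b c = cusumSq F (-c) (-b) (-a) := by
  rw [cusumSq, cusumSq, incrementMean_reflect, incrementMean_reflect, harmonicLength_neg,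
    sub_sq_comm]

theorem segCost_reflect (F : ℤ → ℝ) (n L q : ℝ) :
    segCost (fun x => -F (-x)) n L q = fun a b => segCost F n L q (-b) (-a) := by
  funext a b
  simp only [segCost]
  push_cast
  rw [neg_sub_neg, neg_sub_neg]

theorem incrementMean_mul (F : ℤ → ℝ) (hab : a < b) :
    incrementMean F a b * (b - a) = F b - F a := by
  rify at hab
  exact div_mul_cancel₀ _ (sub_pos.2 hab).ne'

theorem incrementMean_mul_add (F : ℤ → ℝ) (hab : a < b) (hbc : b < c) :
    incrementMean F a b * (b - a) + incrementMean F b c * (c - b) =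
      incrementMean F a c * (c - a) := by
  rw [incrementMean_mul F hab, incrementMean_mul F hbc, incrementMean_mul F (hab.trans hbc)]
  ring

theorem incrementMean_sub_mul (F : ℤ → ℝ) (hab : a < b) (hbc : b < c) :
    (incrementMean F b c - incrementMean F a c) * (c - a) =
      (incrementMean F b c - incrementMean F a b) * (b - a) := by
  linear_combination incrementMean_mul_add F hab hbc

theorem cusumSq_nonneg (F : ℤ → ℝ) (hab : a < b) (hbc : b < c) : 0 ≤ cusumSq F a b c :=
  mul_nonneg (sq_nonneg _) (harmonicLength_pos hab hbc).le

theorem cusumSq_mul_eq (F : ℤ → ℝ) (hab : a < b) (hbc : b < c) :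
    cusumSq F a b c * (b - a) =
      (incrementMean F b c - incrementMean F a c) ^ 2 * ((c - b) * (c - a)) := by
  have hmean := incrementMean_sub_mul F hab hbc
  have hca := sub_pos.2 (Int.cast_lt (R := ℝ).2 (hab.trans hbc))
  rw [cusumSq, harmonicLength, mul_div_assoc', div_mul_eq_mul_div, div_eq_iff hca.ne']
  linear_combination
    -((incrementMean F b c - incrementMean F a b) * (b - a) +
      (incrementMean F b c - incrementMean F a c) * (c - a)) * (c - b) * hmean

theorem segCost_add_sub (F : ℤ → ℝ) {q : ℝ} (hn : n ≠ 0) (hab : a < b) (hbc : b < c) :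
    segCost F n L q a b + segCost F n L q b c - segCost F n L q a c =
      L * scalePenalty n q (harmonicLength a b c) - cusumSq F a b c := by
  have hsq : ∀ {x y : ℤ}, x < y →
      (F y - F x) ^ 2 / ((y : ℝ) - x) = incrementMean F x y ^ 2 * (y - x) := fun hxy => by
    rw [← incrementMean_mul F hxy]
    rify at hxy
    field_simp [(sub_pos.2 hxy).ne']
  have hmean := incrementMean_mul_add F hab hbc
  have hca := sub_pos.2 (Int.cast_lt (R := ℝ).2 (hab.trans hbc))
  have hcusum : cusumSq F a b c = incrementMean F a b ^ 2 * (b - a) +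
      incrementMean F b c ^ 2 * (c - b) - incrementMean F a c ^ 2 * (c - a) := by
    rw [cusumSq, harmonicLength, mul_div_assoc', div_eq_iff hca.ne']
    linear_combination
      (-(incrementMean F a b * (b - a) + incrementMean F b c * (c - b) +
        incrementMean F a c * (c - a))) * hmean
  rw [scalePenalty_harmonicLength q hn hab hbc, hcusum, segCost, segCost, segCost, hsq hab,
    hsq hbc, hsq (hab.trans hbc)]
  ring

/-- The term `2` absorbs the penalty of the short stretch `[a, b)`, whatever its length. -/
theorem sq_incrementMean_sub_le {F : ℤ → ℝ} {q : ℝ} (hn : n ≠ 0) (hL : 0 ≤ L) (hab : a < b)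
    (hbc : b < c) (hpen : 0 ≤ scalePenalty n q (c - b))
    (hcusum : cusumSq F a b c ≤ L * scalePenalty n q (harmonicLength a b c)) :
    (incrementMean F b c - incrementMean F a c) ^ 2 * (c - b) ≤
      L * (scalePenalty n q (c - b) + 2) := by
  have hba := sub_pos.2 (Int.cast_lt (R := ℝ).2 hab)
  have hcb := sub_pos.2 (Int.cast_lt (R := ℝ).2 hbc)
  have hca := sub_pos.2 (Int.cast_lt (R := ℝ).2 (hab.trans hbc))
  refine le_of_mul_le_mul_right ?_ hca
  calc (incrementMean F b c - incrementMean F a c) ^ 2 * (c - b) * (c - a)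
      = cusumSq F a b c * (b - a) := by rw [cusumSq_mul_eq F hab hbc]; ring
    _ ≤ L * (scalePenalty n q (c - b) + 2 * (((c : ℝ) - b) / (b - a))) * (b - a) := by
        gcongr
        exact hcusum.trans
          (mul_le_mul_of_nonneg_left (scalePenalty_harmonicLength_le q hn hab hbc) hL)
    _ = L * (scalePenalty n q (c - b) * (b - a) + 2 * (c - b)) := by field_simp
    _ ≤ L * (scalePenalty n q (c - b) * (c - a) + 2 * (c - a)) := by gcongr
    _ = L * (scalePenalty n q (c - b) + 2) * (c - a) := by ring

theorem segCost_add_le (F : ℤ → ℝ) {q r : ℝ} (hn : 0 < n) (hL : 0 ≤ L) (hr : 0 < r)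
    (hab : r ≤ b - a) (hbc : r ≤ c - b) :
    segCost F n L q a b + segCost F n L q b c ≤
      segCost F n L q a c + L * scalePenalty n q (r / 2) := by
  have hab' : a < b := by rify; linarith
  have hbc' : b < c := by rify; linarith
  have hpen := mul_le_mul_of_nonneg_left
    (scalePenalty_anti q hn (half_pos hr) (half_le_harmonicLength hr hab hbc)) hL
  linarith [segCost_add_sub F (L := L) (q := q) hn.ne' hab' hbc', cusumSq_nonneg F hab' hbc']

end Triads

section Lists

variable {α : Type*} [LinearOrder α]

theorem exists_eq_append_cons_cons_of_notMem {l : List α} (hl : l.Pairwise (· < ·)) {t x y : α}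
    (ht : t ∉ l) (hx : x ∈ l) (hxt : x < t) (hy : y ∈ l) (hty : t < y) :
    ∃ l₁ b c l₂, l = l₁ ++ b :: c :: l₂ ∧ b < t ∧ t < c := by
  induction l generalizing x with
  | nil => simp at hx
  | cons z l ih =>
    rw [List.pairwise_cons] at hl
    have hzt : z < t := by grind
    have hyl : y ∈ l := by grind
    obtain _ | ⟨w, l⟩ := l
    · simp at hyl
    rcases lt_or_gt_of_ne (a := w) (b := t) (by grind) with hwt | htw
    · obtain ⟨l₁, b, c, l₂, heq, hbt, htc⟩ :=
        ih hl.2 (by grind) List.mem_cons_self hwt hyl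
      exact ⟨z :: l₁, b, c, l₂, by rw [heq, List.cons_append], hbt, htc⟩
    · exact ⟨[], z, w, l, rfl, hzt, htw⟩

theorem exists_eq_concat_of_mem_lt {l₁ l₂ : List α} {b x : α}
    (hl : (l₁ ++ b :: l₂).Pairwise (· < ·)) (hx : x ∈ l₁ ++ b :: l₂) (hxb : x < b) :
    ∃ l₀ a, l₁ = l₀ ++ [a] ∧ a < b := by
  rw [List.pairwise_append, List.pairwise_cons] at hl
  obtain rfl | ⟨l₀, a, rfl⟩ := List.eq_nil_or_concat l₁
  · grind
  · exact ⟨l₀, a, List.concat_eq_append, hl.2.2 a (by simp) b (by simp)⟩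

theorem le_or_le_of_mem_append_cons_cons {l₁ l₂ : List α} {b c p : α}
    (hl : (l₁ ++ b :: c :: l₂).Pairwise (· < ·)) (hp : p ∈ l₁ ++ b :: c :: l₂) :
    p ≤ b ∨ c ≤ p := by
  rw [List.pairwise_append, List.pairwise_cons, List.pairwise_cons] at hl
  simp only [List.mem_append, List.mem_cons] at hp
  rcases hp with hp | rfl | rfl | hp
  · exact Or.inl (hl.2.2 p hp b List.mem_cons_self).le
  · exact Or.inl le_rfl
  · exact Or.inr le_rfl
  · exact Or.inr (hl.2.1.2.1 p hp).le

end Lists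

namespace IsLocallyOptimal

theorem lt_of_eq_append {α : Type*} [Preorder α] {G : α → α → ℝ} {l l₁ l₂ : List α} {a b : α}
    (hopt : IsLocallyOptimal G l) (hl : l = l₁ ++ a :: b :: l₂) : a < b := by
  have hsorted := hopt.sorted
  rw [hl, List.pairwise_append, List.pairwise_cons] at hsorted
  exact hsorted.2.1.1 b List.mem_cons_self

variable {F : ℤ → ℝ} {n L q : ℝ} {l l₁ l₂ : List ℤ} {a b c : ℤ}

theorem cusumSq_le (hopt : IsLocallyOptimal (segCost F n L q) l) (hn : n ≠ 0)
    (hl : l = l₁ ++ a :: c :: l₂) (hab : a < b) (hbc : b < c) :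
    cusumSq F a b c ≤ L * scalePenalty n q (harmonicLength a b c) := by
  have hinsert := hopt.le l₁ a [] c l₂ [b] hl (by simp; lia)
  simp only [List.nil_append, List.cons_append, pathCost_cons_cons, pathCost_singleton,
    add_zero] at hinsert
  linarith [segCost_add_sub (L := L) (q := q) F hn hab hbc]

theorem le_cusumSq (hopt : IsLocallyOptimal (segCost F n L q) l) (hn : n ≠ 0)
    (hl : l = l₁ ++ a :: b :: c :: l₂) :
    L * scalePenalty n q (harmonicLength a b c) ≤ cusumSq F a b c := by
  have hab := hopt.lt_of_eq_append hl
  have hbc := hopt.lt_of_eq_append (l₁ := l₁ ++ [a]) (a := b) (by simpa using hl)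
  have hremove := hopt.le l₁ a [b] c l₂ [] hl (by simp; lia)
  simp only [List.nil_append, List.cons_append, pathCost_cons_cons, pathCost_singleton,
    add_zero] at hremove
  linarith [segCost_add_sub (L := L) (q := q) F hn hab hbc]

end IsLocallyOptimal

section NoisyJump

/-- The fraction of the distance to the neighbouring change-points within which a high-energy
change-point is located before the noise around it is taken into account. -/
noncomputable def localizationRatio (L e : ℝ) : ℝ := Real.exp (-(L / (L - e ^ 2) + 4))

/-- The squared energy threshold `κ_L²`, for noise whose CUSUM statistics are at most `e ψ_q`. -/
noncomputable def energyThreshold (L e : ℝ) : ℝ :=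
  16000 * L + 32 * L * (1 + 2 * Real.log (2 / localizationRatio L e)) / localizationRatio L e

variable {L e : ℝ}

theorem localizationRatio_pos (L e : ℝ) : 0 < localizationRatio L e := Real.exp_pos _

theorem localizationRatio_le (hL : 0 ≤ L) (he : e ^ 2 < L) : localizationRatio L e ≤ 1 / 16 := by
  have hexp : (16 : ℝ) ≤ Real.exp 4 := calc
    (16 : ℝ) = 2 ^ 4 := by norm_num
    _ ≤ Real.exp 1 ^ 4 := by gcongr; linarith [Real.exp_one_gt_d9]
    _ = Real.exp 4 := by rw [← Real.exp_nat_mul]; norm_num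
  have hratio : 0 ≤ L / (L - e ^ 2) := div_nonneg hL (sub_pos.2 he).le
  calc localizationRatio L e ≤ Real.exp (-4) := Real.exp_le_exp.2 (by linarith)
    _ ≤ 1 / 16 := by rw [Real.exp_neg, ← one_div]; gcongr

theorem le_mul_log_localizationRatio (he : e ^ 2 < L) :
    L ≤ (L - e ^ 2) * Real.log (1 / localizationRatio L e) := by
  have hcancel : (L - e ^ 2) * (L / (L - e ^ 2)) = L := mul_div_cancel₀ _ (sub_pos.2 he).ne'
  rw [localizationRatio, one_div, ← Real.exp_neg, neg_neg, Real.log_exp, mul_add, hcancel]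
  linarith

theorem log_two_div_localizationRatio_nonneg (hL : 0 ≤ L) (he : e ^ 2 < L) :
    0 ≤ Real.log (2 / localizationRatio L e) :=
  Real.log_nonneg ((one_le_div (localizationRatio_pos L e)).2
    (by linarith [localizationRatio_le hL he]))

theorem le_energyThreshold (hL : 0 ≤ L) (he : e ^ 2 < L) : 16000 * L ≤ energyThreshold L e := by
  have hlog := log_two_div_localizationRatio_nonneg hL he
  have hpos := localizationRatio_pos L e
  exact le_add_of_nonneg_right (by positivity)

theorem le_energyThreshold_mul_localizationRatio (hL : 0 ≤ L) :
    32 * L * (1 + 2 * Real.log (2 / localizationRatio L e)) ≤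
      energyThreshold L e * localizationRatio L e := by
  have hpos := localizationRatio_pos L e
  rw [energyThreshold, add_mul, div_mul_cancel₀ _ hpos.ne']
  exact le_add_of_nonneg_left (by positivity)

/-- The distance from `T` to the closest end of `[s, t)`. -/
def margin (s T t : ℤ) : ℤ := min (T - s) (t - T)

theorem margin_le_left (s T t : ℤ) : (margin s T t : ℝ) ≤ T - s := by
  exact_mod_cast min_le_left (T - s) (t - T)

theorem margin_le_right (s T t : ℤ) : (margin s T t : ℝ) ≤ t - T := by
  exact_mod_cast min_le_right (T - s) (t - T)

theorem margin_neg (s T t : ℤ) : margin (-t) (-T) (-s) = margin s T t := by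
  rw [margin, margin, min_comm]
  congr 1 <;> ring

/-- `F` and `W` are the prefix sums of the data and of the noise. On `[s, t)` the signal jumps once,
at `T`, from `μ₁` to `μ₂`; the jump has high energy, the squared CUSUM statistics of the noise are
at most `e² ψ_q²`, and on stretches of length at least `d` that end or start at `T` the mean of the
noise is small compared to the jump. -/
structure IsNoisyJump (n L q e d μ₁ μ₂ : ℝ) (F W : ℤ → ℝ) (s T t : ℤ) : Prop where
  one_lt : 1 < L
  three_lt : 3 < q
  sq_lt : e ^ 2 < L
  left_lt : s < T
  lt_right : T < t
  length_le : (t : ℝ) - s ≤ n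
  energy_le : energyThreshold L e * scalePenalty n q (margin s T t) ≤
    (μ₂ - μ₁) ^ 2 * margin s T t
  mean_left : ∀ a b, s ≤ a → a < b → b ≤ T → incrementMean F a b = μ₁ + incrementMean W a b
  mean_right : ∀ a b, T ≤ a → a < b → b ≤ t → incrementMean F a b = μ₂ + incrementMean W a b
  cusumSq_le : ∀ a b c, s ≤ a → a < b → b < c → c ≤ t →
    cusumSq W a b c ≤ e ^ 2 * scalePenalty n q (harmonicLength a b c)
  dist_pos : 0 < d
  abs_noise_left_le : ∀ a, s ≤ a → d ≤ (T : ℝ) - a → |incrementMean W a T| ≤ |μ₂ - μ₁| / 40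
  abs_noise_right_le : ∀ a, a ≤ t → d ≤ (a : ℝ) - T → |incrementMean W T a| ≤ |μ₂ - μ₁| / 40

namespace IsNoisyJump

variable {n q d μ₁ μ₂ : ℝ} {F W : ℤ → ℝ} {s T t a b c : ℤ}

theorem reflect (h : IsNoisyJump n L q e d μ₁ μ₂ F W s T t) :
    IsNoisyJump n L q e d μ₂ μ₁ (fun x => -F (-x)) (fun x => -W (-x)) (-t) (-T) (-s) where
  one_lt := h.one_lt
  three_lt := h.three_lt
  sq_lt := h.sq_lt
  left_lt := neg_lt_neg h.lt_right
  lt_right := neg_lt_neg h.left_lt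
  length_le := by push_cast; linarith [h.length_le]
  energy_le := by rw [margin_neg, sub_sq_comm]; exact h.energy_le
  mean_left a b ha hab hb := by
    rw [incrementMean_reflect, incrementMean_reflect]
    exact h.mean_right _ _ (by lia) (by lia) (by lia)
  mean_right a b ha hab hb := by
    rw [incrementMean_reflect, incrementMean_reflect]
    exact h.mean_left _ _ (by lia) (by lia) (by lia)
  cusumSq_le a b c ha hab hbc hc := by
    rw [cusumSq_reflect, ← harmonicLength_neg]
    exact h.cusumSq_le _ _ _ (by lia) (by lia) (by lia) (by lia)
  dist_pos := h.dist_pos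
  abs_noise_left_le a ha hd := by
    rw [incrementMean_reflect, neg_neg, abs_sub_comm]
    exact h.abs_noise_right_le _ (by lia) (by push_cast at hd ⊢; linarith)
  abs_noise_right_le a ha hd := by
    rw [incrementMean_reflect, neg_neg, abs_sub_comm]
    exact h.abs_noise_left_le _ (by lia) (by push_cast at hd ⊢; linarith)

section Energy

theorem one_le_margin (h : IsNoisyJump n L q e d μ₁ μ₂ F W s T t) : (1 : ℝ) ≤ margin s T t := by
  have hs := h.left_lt
  have ht := h.lt_right
  exact_mod_cast le_min (by lia) (by lia)

theorem two_mul_margin_le (h : IsNoisyJump n L q e d μ₁ μ₂ F W s T t) :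
    2 * (margin s T t : ℝ) ≤ n := by
  linarith [margin_le_left s T t, margin_le_right s T t, h.length_le]

theorem n_pos (h : IsNoisyJump n L q e d μ₁ μ₂ F W s T t) : 0 < n := by
  linarith [h.one_le_margin, h.two_mul_margin_le]

theorem localizationRatio_mul_margin_pos (h : IsNoisyJump n L q e d μ₁ μ₂ F W s T t) :
    0 < localizationRatio L e * margin s T t :=
  mul_pos (localizationRatio_pos L e) (zero_lt_one.trans_le h.one_le_margin)

theorem localizationRatio_mul_margin_le (h : IsNoisyJump n L q e d μ₁ μ₂ F W s T t) :
    localizationRatio L e * margin s T t ≤ margin s T t / 16 := by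
  have hle := mul_le_mul_of_nonneg_right
    (localizationRatio_le (zero_lt_one.trans h.one_lt).le h.sq_lt)
    (zero_lt_one.trans_le h.one_le_margin).le
  linarith

theorem three_lt_scalePenalty_margin (h : IsNoisyJump n L q e d μ₁ μ₂ F W s T t) :
    3 < scalePenalty n q (margin s T t) :=
  h.three_lt.trans_le (le_scalePenalty q (by linarith [h.one_le_margin])
    (by linarith [h.one_le_margin, h.two_mul_margin_le]))

theorem mul_scalePenalty_margin_le (h : IsNoisyJump n L q e d μ₁ μ₂ F W s T t) :
    16000 * L * scalePenalty n q (margin s T t) ≤ (μ₂ - μ₁) ^ 2 * margin s T t :=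
  (mul_le_mul_of_nonneg_right (le_energyThreshold (by linarith [h.one_lt]) h.sq_lt)
    (by linarith [h.three_lt_scalePenalty_margin])).trans h.energy_le

theorem mul_scalePenalty_half_lt (h : IsNoisyJump n L q e d μ₁ μ₂ F W s T t) {r : ℝ}
    (hr : localizationRatio L e * margin s T t ≤ r) :
    16 * (L * scalePenalty n q (r / 2)) < (μ₂ - μ₁) ^ 2 * r := by
  have hL := zero_lt_one.trans h.one_lt
  have hm := zero_lt_one.trans_le h.one_le_margin
  have hρ := localizationRatio_pos L e
  have hpen := h.three_lt_scalePenalty_margin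
  have hlog := log_two_div_localizationRatio_nonneg hL.le h.sq_lt
  have hthr := le_energyThreshold_mul_localizationRatio (e := e) hL.le
  have henergy := h.energy_le
  set ρ := localizationRatio L e
  set A := scalePenalty n q (margin s T t) with hA
  set m : ℝ := (margin s T t : ℝ)
  have hshift : scalePenalty n q (r / 2) ≤ (1 + 2 * Real.log (2 / ρ)) * A := calc
    scalePenalty n q (r / 2) ≤ scalePenalty n q (ρ * m / 2) :=
        scalePenalty_anti q h.n_pos (by positivity) (by linarith)
    _ = A + 2 * Real.log (2 / ρ) := by
        rw [scalePenalty_eq_add_log q h.n_pos.ne' (by positivity) hm.ne']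
        congr 3
        field_simp
    _ ≤ (1 + 2 * Real.log (2 / ρ)) * A := by nlinarith
  have hprod : 0 < L * ((1 + 2 * Real.log (2 / ρ)) * A) := by positivity
  calc 16 * (L * scalePenalty n q (r / 2)) ≤ 16 * (L * ((1 + 2 * Real.log (2 / ρ)) * A)) := by
        gcongr
    _ < 32 * L * (1 + 2 * Real.log (2 / ρ)) * A := by linarith
    _ ≤ energyThreshold L e * ρ * A := by gcongr
    _ = energyThreshold L e * A * ρ := by ring
    _ ≤ (μ₂ - μ₁) ^ 2 * m * ρ := by gcongr
    _ = (μ₂ - μ₁) ^ 2 * (ρ * m) := by ring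
    _ ≤ (μ₂ - μ₁) ^ 2 * r := by gcongr

theorem sixteen_mul_lt (h : IsNoisyJump n L q e d μ₁ μ₂ F W s T t) :
    16 * L < (μ₂ - μ₁) ^ 2 * (localizationRatio L e * margin s T t) := by
  have hpos := h.localizationRatio_mul_margin_pos
  have hq : q ≤ scalePenalty n q (localizationRatio L e * margin s T t / 2) :=
    le_scalePenalty q (by positivity)
      (by linarith [h.localizationRatio_mul_margin_le, h.two_mul_margin_le, h.one_le_margin])
  nlinarith [h.mul_scalePenalty_half_lt le_rfl, h.three_lt, h.one_lt]

end Energy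

section Means

theorem abs_incrementMean_left_sub_le (h : IsNoisyJump n L q e d μ₁ μ₂ F W s T t) (hb : s ≤ b)
    (hd : d ≤ (T : ℝ) - b) : |incrementMean F b T - μ₁| ≤ |μ₂ - μ₁| / 40 := by
  have hbT : b < T := by rify; linarith [h.dist_pos]
  rw [h.mean_left b T hb hbT le_rfl, add_sub_cancel_left]
  exact h.abs_noise_left_le b hb hd

theorem abs_incrementMean_right_sub_le (h : IsNoisyJump n L q e d μ₁ μ₂ F W s T t) (hc : c ≤ t)
    (hd : d ≤ (c : ℝ) - T) : |incrementMean F T c - μ₂| ≤ |μ₂ - μ₁| / 40 := by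
  have hTc : T < c := by rify; linarith [h.dist_pos]
  rw [h.mean_right T c le_rfl hTc hc, add_sub_cancel_left]
  exact h.abs_noise_right_le c hc hd

/-- The noise on `[a, b)` is the difference of the noise on `[a, T)` and on `[b, T)`. -/
theorem abs_incrementMean_inner_sub_le (h : IsNoisyJump n L q e d μ₁ μ₂ F W s T t) (ha : s ≤ a)
    (hab : a < b) (hbT : b < T) (hd : d ≤ (T : ℝ) - b) (hlen : (T : ℝ) - b ≤ b - a) :
    |incrementMean F a b - μ₁| ≤ 3 * |μ₂ - μ₁| / 40 := by
  have hlong := h.abs_noise_left_le a ha (by rify at hab; linarith)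
  have hshort := h.abs_noise_left_le b (by lia) hd
  have hadd := incrementMean_mul_add W hab hbT
  rw [h.mean_left a b ha hab hbT.le, add_sub_cancel_left]
  rify at hab hbT
  refine le_of_mul_le_mul_right ?_ (sub_pos.2 hab)
  calc |incrementMean W a b| * (b - a) = |incrementMean W a b * (b - a)| := by
        rw [abs_mul, abs_of_pos (sub_pos.2 hab)]
    _ = |incrementMean W a T * (T - a) - incrementMean W b T * (T - b)| := by
        rw [← hadd, add_sub_cancel_right]
    _ ≤ |incrementMean W a T| * (T - a) + |incrementMean W b T| * (T - b) := by
        refine (abs_sub _ _).trans_eq ?_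
        rw [abs_mul, abs_mul, abs_of_pos (sub_pos.2 hbT),
          abs_of_pos (by linarith : 0 < (T : ℝ) - a)]
    _ ≤ |μ₂ - μ₁| / 40 * (T - a) + |μ₂ - μ₁| / 40 * (T - b) := by gcongr; linarith
    _ ≤ 3 * |μ₂ - μ₁| / 40 * (b - a) := by nlinarith [abs_nonneg (μ₂ - μ₁)]

/-- `hinsert` says that inserting `x` into the fitted segment `[a, b)` does not pay. -/
theorem abs_incrementMean_sub_le (h : IsNoisyJump n L q e d μ₁ μ₂ F W s T t) {x : ℤ} (hax : a < x)
    (hxb : x < b) (hm : (margin s T t : ℝ) ≤ 2 * (b - x)) (hn : (b : ℝ) - x ≤ n)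
    (hinsert : cusumSq F a x b ≤ L * scalePenalty n q (harmonicLength a x b)) :
    |incrementMean F x b - incrementMean F a b| ≤ |μ₂ - μ₁| / 40 := by
  have hL := zero_lt_one.trans h.one_lt
  have hq := h.three_lt
  have hbx : (0 : ℝ) < b - x := by rify at hxb; linarith
  have hm0 := zero_lt_one.trans_le h.one_le_margin
  have hpen := h.three_lt_scalePenalty_margin
  have hle := sq_incrementMean_sub_le h.n_pos.ne' hL.le hax hxb
    (by linarith [le_scalePenalty q hbx hn]) hinsert
  have hpen_le := scalePenalty_le_add_two q h.n_pos.ne' hbx hm0 hm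
  refine abs_le_of_sq_le_sq (le_of_mul_le_mul_right ?_ hbx) (by positivity)
  calc (incrementMean F x b - incrementMean F a b) ^ 2 * (b - x)
      ≤ L * (scalePenalty n q (b - x) + 2) := hle
    _ ≤ L * (5 * scalePenalty n q (margin s T t)) := by gcongr; linarith
    _ ≤ (μ₂ - μ₁) ^ 2 * margin s T t / 3200 := by linarith [h.mul_scalePenalty_margin_le]
    _ ≤ (μ₂ - μ₁) ^ 2 * (2 * (b - x)) / 3200 := by gcongr
    _ = (|μ₂ - μ₁| / 40) ^ 2 * (b - x) := by rw [div_pow, sq_abs]; ring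

theorem abs_incrementMean_outer_sub_le (h : IsNoisyJump n L q e d μ₁ μ₂ F W s T t) (has : a < s)
    (hsb : s < b) (hbT : b < T) (hd : d ≤ (T : ℝ) - b)
    (hm : (margin s T t : ℝ) ≤ 2 * (b - s)) (hlen : (T : ℝ) - b ≤ b - s)
    (hinsert : cusumSq F a s b ≤ L * scalePenalty n q (harmonicLength a s b)) :
    |incrementMean F a b - μ₁| ≤ |μ₂ - μ₁| / 10 := by
  have hlen_n : (b : ℝ) - s ≤ n := by
    have hbt := hbT.trans h.lt_right
    rify at hbt
    linarith [h.length_le]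
  have hsuffix := h.abs_incrementMean_sub_le has hsb hm hlen_n hinsert
  have hinner := h.abs_incrementMean_inner_sub_le le_rfl hsb hbT hd hlen
  rw [abs_sub_comm] at hsuffix
  linarith [abs_sub_le (incrementMean F a b) (incrementMean F s b) μ₁]

end Means
end IsNoisyJump
end NoisyJump

namespace IsNoisyJump

variable {n L q e d μ₁ μ₂ : ℝ} {F W : ℤ → ℝ} {s T t a b c x y : ℤ} {l l₁ l₂ : List ℤ}

section Removal

theorem lt_scalePenalty_harmonicLength (h : IsNoisyJump n L q e d μ₁ μ₂ F W s T t) (ha : s ≤ a)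
    (hab : a < b) (hbc : b < c) (hc : c ≤ t) : 3 < scalePenalty n q (harmonicLength a b c) := by
  refine h.three_lt.trans_le (le_scalePenalty q (harmonicLength_pos hab hbc) ?_)
  have hsb : s ≤ b := by lia
  rify at hc hsb
  linarith [harmonicLength_le_right hab hbc, h.length_le]

theorem cusumSq_le_of_abs_incrementMean_sub_le (h : IsNoisyJump n L q e d μ₁ μ₂ F W s T t)
    (hsb : s ≤ b) (hab : a < b) (hd : d ≤ (T : ℝ) - b)
    (hmean : |incrementMean F a b - μ₁| ≤ |μ₂ - μ₁| / 10) :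
    cusumSq F a b T ≤ (μ₂ - μ₁) ^ 2 * (T - b) / 64 := by
  have hbT : b < T := by rify; linarith [h.dist_pos]
  have hjump : |incrementMean F b T - incrementMean F a b| ≤ |μ₂ - μ₁| / 8 := by
    rw [abs_sub_comm] at hmean
    linarith [abs_sub_le (incrementMean F b T) μ₁ (incrementMean F a b),
      h.abs_incrementMean_left_sub_le hsb hd]
  calc cusumSq F a b T
      = |incrementMean F b T - incrementMean F a b| ^ 2 * harmonicLength a b T := by
        rw [sq_abs, cusumSq]
    _ ≤ (|μ₂ - μ₁| / 8) ^ 2 * (T - b) := by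
        have hH := (harmonicLength_pos hab hbT).le
        gcongr
        exact harmonicLength_le_right hab hbT
    _ = (μ₂ - μ₁) ^ 2 * (T - b) / 64 := by rw [div_pow, sq_abs]; ring

theorem le_segCost_removal (h : IsNoisyJump n L q e d μ₁ μ₂ F W s T t) (hsb : s ≤ b)
    (hab : a < b) (hd : d ≤ (T : ℝ) - b)
    (hmean : |incrementMean F a b - μ₁| ≤ |μ₂ - μ₁| / 10) :
    L * scalePenalty n q (T - b) - (μ₂ - μ₁) ^ 2 * (T - b) / 64 ≤
      segCost F n L q a b + segCost F n L q b T - segCost F n L q a T := by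
  have hbT : b < T := by rify; linarith [h.dist_pos]
  have hpen := mul_le_mul_of_nonneg_left
    (scalePenalty_anti q h.n_pos (harmonicLength_pos hab hbT) (harmonicLength_le_right hab hbT))
    (zero_lt_one.trans h.one_lt).le
  rw [segCost_add_sub F h.n_pos.ne' hab hbT]
  linarith [h.cusumSq_le_of_abs_incrementMean_sub_le hsb hab hd hmean]

theorem cusumSq_le_left (h : IsNoisyJump n L q e d μ₁ μ₂ F W s T t) (ha : s ≤ a) (hab : a < b)
    (hbc : b < c) (hc : c ≤ T) :
    cusumSq F a b c ≤ e ^ 2 * scalePenalty n q (harmonicLength a b c) := by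
  rw [cusumSq, h.mean_left a b ha hab (hbc.le.trans hc), h.mean_left b c (ha.trans hab.le) hbc hc,
    add_sub_add_left_eq_sub]
  exact h.cusumSq_le a b c ha hab hbc (hc.trans h.lt_right.le)

theorem lt_of_consecutive (h : IsNoisyJump n L q e d μ₁ μ₂ F W s T t)
    (hopt : IsLocallyOptimal (segCost F n L q) l) (hl : l = l₁ ++ a :: b :: c :: l₂)
    (hc : c ≤ T) : a < s := by
  by_contra! ha
  have hab := hopt.lt_of_eq_append hl
  have hbc := hopt.lt_of_eq_append (l₁ := l₁ ++ [a]) (a := b) (by simpa using hl)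
  have hpen := h.lt_scalePenalty_harmonicLength ha hab hbc (hc.trans h.lt_right.le)
  have hkept := (hopt.le_cusumSq h.n_pos.ne' hl).trans (h.cusumSq_le_left ha hab hbc hc)
  exact h.sq_lt.not_ge (le_of_mul_le_mul_right hkept (by linarith))

theorem lt_of_sub_le_margin (h : IsNoisyJump n L q e d μ₁ μ₂ F W s T t)
    (hb : (T : ℝ) - b ≤ margin s T t / 4) : s < b := by
  rify
  linarith [h.one_le_margin, margin_le_left s T t]

theorem abs_incrementMean_fitted_sub_le (h : IsNoisyJump n L q e d μ₁ μ₂ F W s T t)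
    (hopt : IsLocallyOptimal (segCost F n L q) l) (hl : l = l₁ ++ a :: b :: l₂) (hbT : b < T)
    (hd : d ≤ (T : ℝ) - b) (hb : (T : ℝ) - b ≤ margin s T t / 4)
    (hlen : a < s ∨ (T : ℝ) - b ≤ b - a) : |incrementMean F a b - μ₁| ≤ |μ₂ - μ₁| / 10 := by
  have hab := hopt.lt_of_eq_append hl
  have hsb := h.lt_of_sub_le_margin hb
  have hm := h.one_le_margin
  have hms := margin_le_left s T t
  rcases lt_or_ge a s with has | hsa
  · exact h.abs_incrementMean_outer_sub_le has hsb hbT hd (by linarith) (by linarith)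
      (hopt.cusumSq_le h.n_pos.ne' hl has hsb)
  · have hinner := h.abs_incrementMean_inner_sub_le hsa hab hbT hd (hlen.resolve_left hsa.not_gt)
    linarith [abs_nonneg (μ₂ - μ₁)]

theorem two_mul_le_of_sub_le (h : IsNoisyJump n L q e d μ₁ μ₂ F W s T t) (hab : a < b)
    (hbT : b < T) (hb : (T : ℝ) - b ≤ localizationRatio L e * margin s T t) :
    2 * L ≤ (L - e ^ 2) * scalePenalty n q (harmonicLength a b T) := by
  have hn := h.n_pos
  have hρ := localizationRatio_pos L e
  have hH := harmonicLength_pos hab hbT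
  have hHn : harmonicLength a b T ≤ localizationRatio L e * n := calc
    harmonicLength a b T ≤ T - b := harmonicLength_le_right hab hbT
    _ ≤ localizationRatio L e * margin s T t := hb
    _ ≤ localizationRatio L e * n := by
      gcongr
      linarith [h.two_mul_margin_le, h.one_le_margin]
  have hpen : 2 * Real.log (1 / localizationRatio L e) ≤
      scalePenalty n q (harmonicLength a b T) := by
    refine le_trans ?_ (scalePenalty_anti q hn hH hHn)
    rw [scalePenalty, div_mul_cancel_right₀ hn.ne', ← one_div]
    linarith [h.three_lt]
  have hgap := mul_le_mul_of_nonneg_left hpen (sub_pos.2 h.sq_lt).le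
  linarith [le_mul_log_localizationRatio h.sq_lt]

theorem le_segCost_removal_pair (h : IsNoisyJump n L q e d μ₁ μ₂ F W s T t) (hs : s ≤ b)
    (hab : a < b) (hbc : b < c) (hcT : c < T) (hd : d ≤ (T : ℝ) - c)
    (hc : (T : ℝ) - c ≤ localizationRatio L e * margin s T t) (hshort : (c : ℝ) - b ≤ T - c)
    (hmean : |incrementMean F a b - μ₁| ≤ |μ₂ - μ₁| / 10) :
    L * scalePenalty n q (T - c) - (μ₂ - μ₁) ^ 2 * (T - c) / 32 ≤
      segCost F n L q a b + segCost F n L q b c + segCost F n L q c T - segCost F n L q a T := by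
  have hL := zero_lt_one.trans h.one_lt
  have hbT := hbc.trans hcT
  have houter := h.le_segCost_removal hs hab (by rify at hbc; linarith) hmean
  have hinner : 2 * L ≤ segCost F n L q b c + segCost F n L q c T - segCost F n L q b T := by
    rw [segCost_add_sub F h.n_pos.ne' hbc hcT]
    linarith [h.cusumSq_le_left hs hbc hcT le_rfl, h.two_mul_le_of_sub_le hbc hcT hc]
  rify at hcT hbT
  have hpen := mul_le_mul_of_nonneg_left (scalePenalty_le_add_two q h.n_pos.ne' (sub_pos.2 hcT)
    (v := T - b) (by linarith) (by linarith)) hL.le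
  have hlen : (μ₂ - μ₁) ^ 2 * (T - b) ≤ (μ₂ - μ₁) ^ 2 * (2 * (T - c)) := by
    gcongr
    linarith
  linarith

/-- At most two fitted points have to be removed: three consecutive ones cannot all lie in
`[s, T)`. -/
theorem exists_removal_left (h : IsNoisyJump n L q e d μ₁ μ₂ F W s T t)
    (hopt : IsLocallyOptimal (segCost F n L q) l) (hx : x ∈ l) (hxs : x ≤ s)
    (hl : l = l₁ ++ b :: l₂) (hbT : b < T) (hd : d ≤ (T : ℝ) - b)
    (hb : (T : ℝ) - b ≤ localizationRatio L e * margin s T t) :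
    ∃ l₀ a r, l₁ ++ [b] = l₀ ++ a :: (r ++ [b]) ∧ a < T ∧
      L * scalePenalty n q (T - b) - (μ₂ - μ₁) ^ 2 * (T - b) / 32 ≤
        pathCost (segCost F n L q) (a :: (r ++ [b])) + segCost F n L q b T -
          segCost F n L q a T := by
  have hm := h.one_le_margin
  have hρm := h.localizationRatio_mul_margin_le
  have hsb := h.lt_of_sub_le_margin (b := b) (by linarith)
  subst hl
  obtain ⟨l₁, a, rfl, hab⟩ := exists_eq_concat_of_mem_lt hopt.sorted hx (by lia)
  by_cases hlen : a < s ∨ (T : ℝ) - b ≤ b - a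
  · have hmean := h.abs_incrementMean_fitted_sub_le (l₁ := l₁) (l₂ := l₂) hopt (by simp) hbT hd
      (by linarith) hlen
    have hgain : 0 ≤ (μ₂ - μ₁) ^ 2 * ((T : ℝ) - b) :=
      mul_nonneg (sq_nonneg _) (by linarith [h.dist_pos])
    refine ⟨l₁, a, [], by simp, hab.trans hbT, ?_⟩
    simp only [List.nil_append, pathCost_cons_cons, pathCost_singleton]
    linarith [h.le_segCost_removal hsb.le hab hd hmean]
  · push Not at hlen
    have hsa : s < a := h.lt_of_sub_le_margin (by linarith)
    rw [List.append_assoc, List.singleton_append] at hopt hx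
    obtain ⟨l₁, a', rfl, ha'⟩ := exists_eq_concat_of_mem_lt hopt.sorted hx (by lia)
    have hba : (a : ℝ) < b := Int.cast_lt.2 hab
    have has' : a' < s := h.lt_of_consecutive hopt (l₁ := l₁) (b := a) (l₂ := l₂) (by simp) hbT.le
    have hmean := h.abs_incrementMean_fitted_sub_le (l₁ := l₁) (b := a) (l₂ := b :: l₂) hopt
      (by simp) (hab.trans hbT) (by linarith) (by linarith) (Or.inl has')
    refine ⟨l₁, a', [a], by simp, by lia, ?_⟩
    simp only [List.cons_append, List.nil_append, pathCost_cons_cons, pathCost_singleton]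
    linarith [h.le_segCost_removal_pair hsa.le ha' hab hbT hd hb hlen.2.le hmean]

theorem exists_removal_right (h : IsNoisyJump n L q e d μ₁ μ₂ F W s T t)
    (hopt : IsLocallyOptimal (segCost F n L q) l) (hy : y ∈ l) (hty : t ≤ y)
    (hl : l = l₁ ++ c :: l₂) (hTc : T < c) (hd : d ≤ (c : ℝ) - T)
    (hc : (c : ℝ) - T ≤ localizationRatio L e * margin s T t) :
    ∃ r a l₀, c :: l₂ = c :: (r ++ a :: l₀) ∧ T < a ∧
      L * scalePenalty n q (c - T) - (μ₂ - μ₁) ^ 2 * (c - T) / 32 ≤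
        pathCost (segCost F n L q) (c :: (r ++ [a])) + segCost F n L q T c -
          segCost F n L q T a := by
  have hcast : ((-T : ℤ) : ℝ) - (-c : ℤ) = c - T := by push_cast; ring
  obtain ⟨l₀, a, r, heq, haT, hgain⟩ := h.reflect.exists_removal_left (b := -c) (x := -y)
    (l₁ := (l₂.map Neg.neg).reverse) (l₂ := (l₁.map Neg.neg).reverse)
    (by rw [segCost_reflect]; exact hopt.reflect) (by simpa using hy) (neg_le_neg hty)
    (by rw [hl]; simp) (neg_lt_neg hTc) (by rwa [hcast]) (by rwa [hcast, margin_neg])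
  refine ⟨(r.map Neg.neg).reverse, -a, (l₀.map Neg.neg).reverse, ?_, by lia, ?_⟩
  · simpa [List.map_reverse] using congrArg (fun l => (l.map Neg.neg).reverse) heq
  · have hcost : pathCost (fun a b => segCost F n L q (-b) (-a)) (a :: (r ++ [-c])) =
        pathCost (segCost F n L q) (c :: ((r.map Neg.neg).reverse ++ [-a])) := by
      rw [← pathCost_map (fun a b => segCost F n L q b a), ← pathCost_reverse]
      simp
    rw [segCost_reflect, hcast, hcost, sub_sq_comm] at hgain
    simpa only [neg_neg] using hgain

end Removal

section Localization

theorem cusumSq_le_of_spanning (h : IsNoisyJump n L q e d μ₁ μ₂ F W s T t)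
    (hopt : IsLocallyOptimal (segCost F n L q) l) (hl : l = l₁ ++ a :: c :: l₂) {r : ℝ}
    (hr : 0 < r) (hrn : r ≤ n) (hx : x = a ∨ r ≤ (x : ℝ) - a) (hxT : r ≤ (T : ℝ) - x)
    (hTy : r ≤ (y : ℝ) - T) (hy : y = c ∨ r ≤ (c : ℝ) - y) :
    cusumSq F x T y ≤ 3 * (L * scalePenalty n q (r / 2)) := by
  have hL := (zero_lt_one.trans h.one_lt).le
  have hxT' : x < T := by rify; linarith
  have hTy' : T < y := by rify; linarith
  have hq : 0 ≤ L * scalePenalty n q (r / 2) :=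
    mul_nonneg hL (by linarith [h.three_lt, le_scalePenalty q (half_pos hr) (n := n) (by linarith)])
  have hmiddle : segCost F n L q x T + segCost F n L q T y ≤
      segCost F n L q x y + L * scalePenalty n q (r / 2) - cusumSq F x T y := by
    have hpen := mul_le_mul_of_nonneg_left (scalePenalty_anti q h.n_pos (half_pos hr)
      (half_le_harmonicLength hr hxT hTy)) hL
    linarith [segCost_add_sub (L := L) (q := q) F h.n_pos.ne' hxT' hTy']
  have hinsert := fun s' hs' => hopt.le l₁ a [] c l₂ s' hl hs'
  have hsplit : ∀ {u v w : ℤ}, r ≤ (v : ℝ) - u → r ≤ (w : ℝ) - v →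
      segCost F n L q u v + segCost F n L q v w ≤
        segCost F n L q u w + L * scalePenalty n q (r / 2) :=
    fun huv hvw => segCost_add_le F h.n_pos hL hr huv hvw
  have hlt : ∀ {u v : ℤ}, r ≤ (v : ℝ) - u → u < v := fun huv => by rify; linarith
  simp only [List.nil_append, pathCost_cons_cons, pathCost_singleton, add_zero] at hinsert
  rcases hx with rfl | hx <;> rcases hy with rfl | hy
  · have hle := hinsert [T] (by simp; lia)
    simp only [List.cons_append, List.nil_append, pathCost_cons_cons, pathCost_singleton] at hle
    linarith
  · have hyc := hlt hy
    have hle := hinsert [T, y] (by simp; lia)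
    simp only [List.cons_append, List.nil_append, pathCost_cons_cons, pathCost_singleton] at hle
    linarith [hsplit (u := x) (v := y) (w := c) (by linarith) hy]
  · have hax := hlt hx
    have hle := hinsert [x, T] (by simp; lia)
    simp only [List.cons_append, List.nil_append, pathCost_cons_cons, pathCost_singleton] at hle
    linarith [hsplit (u := a) (v := x) (w := y) hx (by linarith)]
  · have hax := hlt hx
    have hyc := hlt hy
    have hle := hinsert [x, T, y] (by simp; lia)
    simp only [List.cons_append, List.nil_append, pathCost_cons_cons, pathCost_singleton] at hle
    linarith [hsplit (u := a) (v := x) (w := c) hx (by linarith),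
      hsplit (u := x) (v := y) (w := c) (by linarith) hy]

theorem sq_mul_le_of_cusumSq_le (h : IsNoisyJump n L q e d μ₁ μ₂ F W s T t) {r : ℝ} (hr : 0 < r)
    (hsx : s ≤ x) (hyt : y ≤ t) (hxT : r ≤ (T : ℝ) - x) (hTy : r ≤ (y : ℝ) - T)
    (hcusum : cusumSq F x T y ≤ 3 * (L * scalePenalty n q (r / 2))) :
    (μ₂ - μ₁) ^ 2 * r ≤ 16 * (L * scalePenalty n q (r / 2)) := by
  have hxT' : x < T := by rify; linarith
  have hTy' : T < y := by rify; linarith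
  have hH := half_le_harmonicLength hr hxT hTy
  have hnoise : cusumSq W x T y ≤ L * scalePenalty n q (r / 2) := by
    have hpen := h.lt_scalePenalty_harmonicLength hsx hxT' hTy' hyt
    calc cusumSq W x T y ≤ e ^ 2 * scalePenalty n q (harmonicLength x T y) :=
          h.cusumSq_le x T y hsx hxT' hTy' hyt
      _ ≤ L * scalePenalty n q (harmonicLength x T y) :=
          mul_le_mul_of_nonneg_right h.sq_lt.le (by linarith)
      _ ≤ L * scalePenalty n q (r / 2) :=
          mul_le_mul_of_nonneg_left (scalePenalty_anti q h.n_pos (half_pos hr) hH)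
            (zero_lt_one.trans h.one_lt).le
  have hjump : (μ₂ - μ₁) ^ 2 ≤ 2 * (incrementMean F T y - incrementMean F x T) ^ 2 +
      2 * (incrementMean W T y - incrementMean W x T) ^ 2 := by
    rw [h.mean_left x T hsx hxT' le_rfl, h.mean_right T y le_rfl hTy' hyt]
    nlinarith [sq_nonneg (μ₂ - μ₁ + 2 * (incrementMean W T y - incrementMean W x T))]
  calc (μ₂ - μ₁) ^ 2 * r = 2 * ((μ₂ - μ₁) ^ 2 * (r / 2)) := by ring
    _ ≤ 2 * ((2 * (incrementMean F T y - incrementMean F x T) ^ 2 +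
        2 * (incrementMean W T y - incrementMean W x T) ^ 2) * harmonicLength x T y) := by gcongr
    _ = 4 * cusumSq F x T y + 4 * cusumSq W x T y := by rw [cusumSq, cusumSq]; ring
    _ ≤ 16 * (L * scalePenalty n q (r / 2)) := by linarith

theorem two_mul_ceil_sub_one_le_margin (h : IsNoisyJump n L q e d μ₁ μ₂ F W s T t) :
    2 * ⌈localizationRatio L e * margin s T t⌉ - 1 ≤ margin s T t := by
  have hm := h.one_le_margin
  have hρm := h.localizationRatio_mul_margin_le
  rcases le_total (localizationRatio L e * margin s T t) 1 with hle | hle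
  · have hceil : ⌈localizationRatio L e * margin s T t⌉ ≤ 1 := Int.ceil_le.2 (by simpa using hle)
    have hm' : 1 ≤ margin s T t := by exact_mod_cast hm
    lia
  · rify
    linarith [Int.ceil_lt_add_one (localizationRatio L e * margin s T t)]

theorem exists_mem_abs_sub_lt_localizationRatio (h : IsNoisyJump n L q e d μ₁ μ₂ F W s T t)
    (hopt : IsLocallyOptimal (segCost F n L q) l) (hx : x ∈ l) (hxs : x ≤ s) (hy : y ∈ l)
    (hty : t ≤ y) : ∃ p ∈ l, |(p : ℝ) - T| < localizationRatio L e * margin s T t := by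
  by_contra! hfar
  have hsT := h.left_lt
  have hTt := h.lt_right
  have hpos := h.localizationRatio_mul_margin_pos
  have hT : T ∉ l := fun hT => (hfar T hT).not_gt (by simpa using hpos)
  obtain ⟨l₁, a, c, l₂, hl, haT, hTc⟩ := exists_eq_append_cons_cons_of_notMem hopt.sorted hT hx
    (by lia) hy (by lia)
  have hfar_ceil : ∀ p ∈ l, ⌈localizationRatio L e * margin s T t⌉ ≤ |p - T| := fun p hp =>
    Int.ceil_le.2 (by exact_mod_cast hfar p hp)
  have hR := Int.le_ceil (localizationRatio L e * margin s T t)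
  have hR_pos : 0 < ⌈localizationRatio L e * margin s T t⌉ := Int.ceil_pos.2 hpos
  have hR_margin := h.two_mul_ceil_sub_one_le_margin
  generalize ⌈localizationRatio L e * margin s T t⌉ = R at *
  have hms : margin s T t ≤ T - s := min_le_left _ _
  have hmt : margin s T t ≤ t - T := min_le_right _ _
  have haR : R ≤ T - a := by
    simpa [abs_sub_comm, abs_of_pos (sub_pos.2 haT)] using hfar_ceil a (by simp [hl])
  have hcR : R ≤ c - T := by
    simpa [abs_of_pos (sub_pos.2 hTc)] using hfar_ceil c (by simp [hl])
  obtain ⟨u, hsu, huT, hua⟩ : ∃ u, s ≤ u ∧ R ≤ T - u ∧ (u = a ∨ R ≤ u - a) := by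
    rcases lt_or_ge (T - a) (2 * R) with hshort | hlong
    · exact ⟨a, by lia, haR, Or.inl rfl⟩
    · exact ⟨T - R, by lia, by lia, Or.inr (by lia)⟩
  obtain ⟨v, hvt, hTv, hvc⟩ : ∃ v, v ≤ t ∧ R ≤ v - T ∧ (v = c ∨ R ≤ c - v) := by
    rcases lt_or_ge (c - T) (2 * R) with hshort | hlong
    · exact ⟨c, by lia, hcR, Or.inl rfl⟩
    · exact ⟨T + R, by lia, by lia, Or.inr (by lia)⟩
  have hRn : (R : ℝ) ≤ n := by
    rify at hR_margin
    linarith [h.two_mul_margin_le, h.one_le_margin]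
  rify at hR_pos huT hTv hua hvc
  exact (h.sq_mul_le_of_cusumSq_le hR_pos hsu hvt huT hTv
    (h.cusumSq_le_of_spanning hopt hl hR_pos hRn (by exact_mod_cast hua) huT hTv
      (by exact_mod_cast hvc))).not_gt (h.mul_scalePenalty_half_lt hR)

end Localization

section Refinement

theorem le_abs_incrementMean_right_sub (h : IsNoisyJump n L q e d μ₁ μ₂ F W s T t) (hsx : s ≤ x)
    (hct : c ≤ t) (hd : d ≤ (c : ℝ) - T) (hle : (c : ℝ) - T ≤ T - x) :
    19 * |μ₂ - μ₁| / 40 ≤ |incrementMean F T c - incrementMean F x c| := by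
  have hxT : x < T := by rify; linarith [h.dist_pos]
  have hTc : T < c := by rify; linarith [h.dist_pos]
  have hleft := h.abs_incrementMean_left_sub_le hsx (hd.trans hle)
  have hright := h.abs_incrementMean_right_sub_le hct hd
  have hjump : 19 * |μ₂ - μ₁| / 20 ≤ |incrementMean F T c - incrementMean F x T| := by
    rw [abs_sub_comm] at hright
    linarith [abs_sub_le μ₂ (incrementMean F T c) μ₁,
      abs_sub_le (incrementMean F T c) (incrementMean F x T) μ₁]
  have hmean := congrArg abs (incrementMean_sub_mul F hxT hTc)
  rify at hxT hTc
  rw [abs_mul, abs_mul, abs_of_pos (by linarith : (0 : ℝ) < c - x),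
    abs_of_pos (sub_pos.2 hxT)] at hmean
  refine le_of_mul_le_mul_right ?_ (by linarith : (0 : ℝ) < c - x)
  calc 19 * |μ₂ - μ₁| / 40 * (c - x) ≤ 19 * |μ₂ - μ₁| / 40 * (2 * (T - x)) := by
        gcongr
        linarith
    _ = 19 * |μ₂ - μ₁| / 20 * (T - x) := by ring
    _ ≤ |incrementMean F T c - incrementMean F x T| * (T - x) := by gcongr
    _ = |incrementMean F T c - incrementMean F x c| * (c - x) := hmean.symm

theorem lt_of_sub_le_localizationRatio (h : IsNoisyJump n L q e d μ₁ μ₂ F W s T t)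
    (hc : (c : ℝ) - T ≤ localizationRatio L e * margin s T t) : c < t := by
  rify
  linarith [h.localizationRatio_mul_margin_le, h.one_le_margin, margin_le_right s T t]

theorem le_abs_incrementMean_right_sub_of_fitted (h : IsNoisyJump n L q e d μ₁ μ₂ F W s T t)
    (hopt : IsLocallyOptimal (segCost F n L q) l) (hl : l = l₁ ++ b :: c :: l₂)
    (hd : d ≤ (c : ℝ) - T) (hle : (c : ℝ) - T ≤ T - b)
    (hc : (c : ℝ) - T ≤ localizationRatio L e * margin s T t) :
    9 * |μ₂ - μ₁| / 20 ≤ |incrementMean F T c - incrementMean F b c| := by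
  have hct := h.lt_of_sub_le_localizationRatio hc
  rcases le_or_gt s b with hsb | hbs
  · linarith [h.le_abs_incrementMean_right_sub hsb hct.le hd hle, abs_nonneg (μ₂ - μ₁)]
  · have hTc : T < c := by rify; linarith [h.dist_pos]
    have hsc := h.left_lt.trans hTc
    have hms := margin_le_left s T t
    have hlong := h.le_abs_incrementMean_right_sub le_rfl hct.le hd
      (by linarith [h.localizationRatio_mul_margin_le, h.one_le_margin])
    have hinsert := hopt.cusumSq_le h.n_pos.ne' hl hbs hsc
    rify at hTc hct
    have hclose := h.abs_incrementMean_sub_le hbs hsc (by linarith [h.one_le_margin])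
      (by linarith [h.length_le]) hinsert
    rw [abs_sub_comm] at hclose
    linarith [abs_sub_le (incrementMean F T c) (incrementMean F b c) (incrementMean F s c)]

theorem le_cusumSq_of_fitted (h : IsNoisyJump n L q e d μ₁ μ₂ F W s T t)
    (hopt : IsLocallyOptimal (segCost F n L q) l) (hl : l = l₁ ++ b :: c :: l₂)
    (hd : d ≤ (c : ℝ) - T) (hle : (c : ℝ) - T ≤ T - b)
    (hc : (c : ℝ) - T ≤ localizationRatio L e * margin s T t) :
    (μ₂ - μ₁) ^ 2 * (c - T) / 5 ≤ cusumSq F b T c := by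
  have hjump := h.le_abs_incrementMean_right_sub_of_fitted hopt hl hd hle hc
  have hbT : b < T := by rify; linarith [h.dist_pos]
  have hTc : T < c := by rify; linarith [h.dist_pos]
  have heq := cusumSq_mul_eq F hbT hTc
  rify at hbT hTc
  have := sub_pos.2 hTc
  refine le_of_mul_le_mul_right ?_ (sub_pos.2 hbT)
  calc (μ₂ - μ₁) ^ 2 * (c - T) / 5 * (T - b) = (μ₂ - μ₁) ^ 2 / 5 * ((c - T) * (T - b)) := by ring
    _ ≤ (9 * |μ₂ - μ₁| / 20) ^ 2 * ((c - T) * (c - b)) := by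
        gcongr
        rw [div_pow, mul_pow, sq_abs]
        linarith [sq_nonneg (μ₂ - μ₁)]
    _ ≤ |incrementMean F T c - incrementMean F b c| ^ 2 * ((c - T) * (c - b)) := by
        have := sub_pos.2 (hbT.trans hTc)
        gcongr
    _ = cusumSq F b T c * (T - b) := by rw [sq_abs, heq]

/-- Otherwise it would pay to replace the fitted points around `T` by `T` alone. -/
theorem sixteen_mul_le_of_fitted (h : IsNoisyJump n L q e d μ₁ μ₂ F W s T t)
    (hopt : IsLocallyOptimal (segCost F n L q) l) (hx : x ∈ l) (hxs : x ≤ s) (hy : y ∈ l)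
    (hty : t ≤ y) (hl : l = l₁ ++ b :: c :: l₂) (hd : d ≤ (c : ℝ) - T)
    (hle : (c : ℝ) - T ≤ T - b) : 16 * L ≤ (μ₂ - μ₁) ^ 2 * (T - b) := by
  by_contra! hlt
  have hbT : b < T := by rify; linarith [h.dist_pos]
  have hTc : T < c := by rify; linarith [h.dist_pos]
  have hb : (T : ℝ) - b ≤ localizationRatio L e * margin s T t :=
    (lt_of_mul_lt_mul_left (hlt.trans h.sixteen_mul_lt) (sq_nonneg _)).le
  obtain ⟨l₀, a, r, heq, haT, hleft⟩ := h.exists_removal_left hopt hx hxs hl hbT (hd.trans hle) hb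
  obtain ⟨r', a', l₀', heq', hTa', hright⟩ := h.exists_removal_right (l₁ := l₁ ++ [b]) hopt hy hty
    (by simpa using hl) hTc hd (hle.trans hb)
  have hl' : l = l₀ ++ a :: ((r ++ b :: c :: r') ++ a' :: l₀') := by
    rw [hl, heq', ← List.singleton_append (x := b), ← List.append_assoc, heq]
    simp
  have hreplace := hopt.le l₀ a _ a' l₀' [T] hl' (by simp; lia)
  have hpath := pathCost_append_cons (segCost F n L q) (a :: r) b (c :: (r' ++ [a']))
  simp only [List.cons_append, List.append_assoc, List.nil_append, pathCost_cons_cons,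
    pathCost_singleton] at hreplace hpath hleft hright
  have hsplit := segCost_add_sub (L := L) (q := q) F h.n_pos.ne' hbT hTc
  rw [scalePenalty_harmonicLength q h.n_pos.ne' hbT hTc] at hsplit
  have hpen : L * 3 < L * scalePenalty n q (c - b) := by
    refine mul_lt_mul_of_pos_left (h.three_lt.trans_le (le_scalePenalty q ?_ ?_))
      (zero_lt_one.trans h.one_lt)
    · linarith [h.dist_pos]
    · linarith [h.localizationRatio_mul_margin_le, h.two_mul_margin_le, h.one_le_margin]
  have hgain : (μ₂ - μ₁) ^ 2 * (c - T) ≤ (μ₂ - μ₁) ^ 2 * (T - b) := by gcongr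
  linarith [cusumSq_nonneg F hbT hTc, h.one_lt]

theorem sub_lt_of_fitted (h : IsNoisyJump n L q e d μ₁ μ₂ F W s T t)
    (hopt : IsLocallyOptimal (segCost F n L q) l) (hx : x ∈ l) (hxs : x ≤ s) (hy : y ∈ l)
    (hty : t ≤ y) (hl : l = l₁ ++ b :: c :: l₂) (hle : (c : ℝ) - T ≤ T - b)
    (hc : (c : ℝ) - T ≤ localizationRatio L e * margin s T t) : (c : ℝ) - T < d := by
  by_contra! hd
  have hL := zero_lt_one.trans h.one_lt
  have hb := h.sixteen_mul_le_of_fitted hopt hx hxs hy hty hl hd hle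
  have hbT : b < T := by rify; linarith [h.dist_pos]
  have hTc : T < c := by rify; linarith [h.dist_pos]
  obtain ⟨r, a, l₀, heq, hTa, hright⟩ := h.exists_removal_right (l₁ := l₁ ++ [b]) hopt hy hty
    (by simpa using hl) hTc hd hc
  have hreplace := hopt.le l₁ b (c :: r) a l₀ [T] (by rw [hl, heq]; simp) (by simp; lia)
  simp only [List.cons_append, List.nil_append, pathCost_cons_cons,
    pathCost_singleton] at hreplace hright
  have hsplit := segCost_add_sub (L := L) (q := q) F h.n_pos.ne' hbT hTc
  have hpen := mul_le_mul_of_nonneg_left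
    (scalePenalty_harmonicLength_le q h.n_pos.ne' hbT hTc) hL.le
  have hcusum := h.le_cusumSq_of_fitted hopt hl hd hle hc
  rify at hbT hTc
  have hTb := sub_pos.2 hbT
  have hcT := sub_pos.2 hTc
  have hratio : L * (((c : ℝ) - T) / (T - b)) ≤ (μ₂ - μ₁) ^ 2 * (c - T) / 16 := by
    rw [mul_div_assoc', div_le_iff₀ hTb]
    nlinarith
  have hjump : 0 < (μ₂ - μ₁) ^ 2 * ((c : ℝ) - T) :=
    mul_pos (pos_of_mul_pos_left (by linarith : 0 < (μ₂ - μ₁) ^ 2 * ((T : ℝ) - b)) hTb.le) hcT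
  linarith

theorem exists_mem_abs_sub_lt (h : IsNoisyJump n L q e d μ₁ μ₂ F W s T t)
    (hopt : IsLocallyOptimal (segCost F n L q) l) (hx : x ∈ l) (hxs : x ≤ s) (hy : y ∈ l)
    (hty : t ≤ y) : ∃ p ∈ l, s < p ∧ p < t ∧ |(p : ℝ) - T| < d := by
  by_cases hT : T ∈ l
  · exact ⟨T, hT, h.left_lt, h.lt_right, by simpa using h.dist_pos⟩
  obtain ⟨p, hp, hpT⟩ := h.exists_mem_abs_sub_lt_localizationRatio hopt hx hxs hy hty
  obtain ⟨l₁, b, c, l₂, hl, hbT, hTc⟩ := exists_eq_append_cons_cons_of_notMem hopt.sorted hT hx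
    (hxs.trans_lt h.left_lt) hy (h.lt_right.trans_le hty)
  have hbcp : p ≤ b ∨ c ≤ p :=
    le_or_le_of_mem_append_cons_cons (hl ▸ hopt.sorted) (hl ▸ hp)
  have hnear : min ((T : ℝ) - b) (c - T) ≤ localizationRatio L e * margin s T t := by
    refine le_trans ?_ hpT.le
    rcases hbcp with hpb | hcp
    · rify at hpb
      exact min_le_of_left_le (by linarith [neg_le_abs ((p : ℝ) - T)])
    · rify at hcp
      exact min_le_of_right_le (by linarith [le_abs_self ((p : ℝ) - T)])
  rcases le_total ((c : ℝ) - T) (T - b) with hle | hle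
  · rw [min_eq_right hle] at hnear
    refine ⟨c, by simp [hl], h.left_lt.trans hTc, h.lt_of_sub_le_localizationRatio hnear, ?_⟩
    rw [abs_of_pos (sub_pos.2 (by exact_mod_cast hTc))]
    exact h.sub_lt_of_fitted hopt hx hxs hy hty hl hle hnear
  · rw [min_eq_left hle] at hnear
    have hcast : ∀ u v : ℤ, ((-u : ℤ) : ℝ) - (-v : ℤ) = v - u := fun u v => by push_cast; ring
    have hnear' : ((-b : ℤ) : ℝ) - (-T : ℤ) ≤ localizationRatio L e * margin (-t) (-T) (-s) := by
      rwa [hcast, margin_neg]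
    refine ⟨b, by simp [hl], neg_lt_neg_iff.1 (h.reflect.lt_of_sub_le_localizationRatio hnear'),
      hbT.trans h.lt_right, ?_⟩
    rw [abs_sub_comm, abs_of_pos (sub_pos.2 (by exact_mod_cast hbT)), ← hcast]
    exact h.reflect.sub_lt_of_fitted (l₁ := (l₂.map Neg.neg).reverse) (b := -c)
      (l₂ := (l₁.map Neg.neg).reverse) (x := -y) (y := -x)
      (by rw [segCost_reflect]; exact hopt.reflect) (by simpa using hy) (neg_le_neg hty)
      (by simpa using hx) (neg_le_neg hxs) (by rw [hl]; simp) (by rwa [hcast, hcast]) hnear'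

end Refinement

end IsNoisyJump

section Translation

variable {n : ℕ} {q : ℝ}

theorem cusum_sq (v : Fin n → ℝ) {a b c : ℕ} (hab : a < b) (hbc : b < c) :
    cusum v a b c ^ 2 = cusumSq (prefixSum v) a b c := by
  have hlen : 0 ≤ harmonicLength a b c :=
    (harmonicLength_pos (by exact_mod_cast hab) (by exact_mod_cast hbc)).le
  rw [harmonicLength] at hlen
  push_cast at hlen
  rw [cusum, mul_pow, Real.sq_sqrt hlen, segmentSum_eq_prefixSum_sub v hab.le,
    segmentSum_eq_prefixSum_sub v hbc.le, cusumSq, incrementMean, incrementMean, harmonicLength]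
  push_cast
  rfl

theorem psi_sq (hq : 0 ≤ q) {a b c : ℕ} (ha : 1 ≤ a) (hab : a < b) (hbc : b < c)
    (hc : c ≤ n + 1) : psi n q a b c ^ 2 = scalePenalty n q (harmonicLength a b c) := by
  have hpos : 0 < harmonicLength a b c :=
    harmonicLength_pos (by exact_mod_cast hab) (by exact_mod_cast hbc)
  have hle : harmonicLength a b c ≤ n :=
    (harmonicLength_le_right (by exact_mod_cast hab) (by exact_mod_cast hbc)).trans (by
      have : c ≤ n + b := by lia
      rify at this
      push_cast
      linarith)
  have harg : (n : ℝ) * ((c : ℝ) - a) / (((c : ℝ) - b) * ((b : ℝ) - a)) =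
      n / harmonicLength a b c := by
    rw [harmonicLength, div_div_eq_mul_div, mul_comm ((c : ℝ) - b)]
    push_cast
    rfl
  rw [psi, harg]
  exact Real.sq_sqrt (hq.trans (le_scalePenalty q hpos hle))

theorem HasChangePoints.incrementMean_eq {θ : Fin n → ℝ} {τ : ChangePointVector n}
    {m : Fin (τ.len + 1) → ℝ} (h : HasChangePoints θ τ m) (k : Fin (τ.len + 1)) {a b : ℤ}
    (ha : τ.pos k.castSucc ≤ a) (hab : a < b) (hb : b ≤ τ.pos k.succ) :
    incrementMean (prefixSum θ) a b = m k := by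
  lift a to ℕ using by lia
  lift b to ℕ using by lia
  have hconst : segmentSum θ a b = segmentSum (fun _ => m k) a b :=
    segmentSum_congr fun i hi => (h.eq_sum i).trans
      (τ.sum_ite_segment m ⟨(by exact_mod_cast ha : _ ≤ a).trans hi.1,
        hi.2.trans_le (by exact_mod_cast hb)⟩)
  have hone := τ.one_le_pos k.castSucc
  have hle := τ.pos_le k.succ
  have hab' : (0 : ℝ) < b - a := sub_pos.2 (by exact_mod_cast hab)
  rw [incrementMean, ← segmentSum_eq_prefixSum_sub θ (by lia), hconst,
    segmentSum_const _ (by lia) (by lia) (by lia)]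
  exact mul_div_cancel_right₀ _ hab'.ne'

theorem HasChangePoints.incrementMean_add {θ : Fin n → ℝ} {τ : ChangePointVector n}
    {m : Fin (τ.len + 1) → ℝ} (h : HasChangePoints θ τ m) (w : Fin n → ℝ) (k : Fin (τ.len + 1))
    {a b : ℤ} (ha : τ.pos k.castSucc ≤ a) (hab : a < b) (hb : b ≤ τ.pos k.succ) :
    incrementMean (prefixSum fun i => θ i + w i) a b = m k + incrementMean (prefixSum w) a b := by
  rw [← h.incrementMean_eq k ha hab hb]
  simp only [incrementMean, prefixSum_add]
  ring

namespace ChangePointVector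

theorem one_le_prev (τ : ChangePointVector n) (k : Fin τ.len) : 1 ≤ τ.prev k := τ.one_le_pos _

theorem next_le (τ : ChangePointVector n) (k : Fin τ.len) : τ.next k ≤ n + 1 := τ.pos_le _

theorem prev_lt_point (τ : ChangePointVector n) (k : Fin τ.len) : τ.prev k < τ.point k :=
  τ.pos_castSucc_lt_succ k.castSucc

theorem point_lt_next (τ : ChangePointVector n) (k : Fin τ.len) : τ.point k < τ.next k :=
  τ.pos_castSucc_lt_succ k.succ

theorem one_mem_toList (τ : ChangePointVector n) : 1 ∈ τ.toList :=
  List.mem_of_mem_head? (by rw [τ.head?_toList, Option.mem_some])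

theorem add_one_mem_toList (τ : ChangePointVector n) : (n + 1 : ℤ) ∈ τ.toList :=
  List.mem_of_mem_getLast? (by rw [τ.getLast?_toList, Option.mem_some])

theorem distTo_le {τ : ChangePointVector n} {p : ℤ} (hp : p ∈ τ.toList) (hone : 1 < p)
    (hlast : p < n + 1) (t : ℕ) : distTo τ t ≤ ENNReal.ofReal |(p : ℝ) - t| := by
  obtain ⟨i, rfl⟩ := List.mem_ofFn.1 hp
  obtain ⟨j, rfl⟩ := Fin.exists_succ_eq.2 (fun hi : i = 0 => by simp [hi, τ.pos_zero] at hone)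
  obtain ⟨l, rfl⟩ := Fin.exists_castSucc_eq.2
    (fun hj : j = Fin.last _ => by simp [hj, τ.pos_last] at hlast)
  simpa using! iInf_le (fun l => ENNReal.ofReal |(τ.point l : ℝ) - t|) l

end ChangePointVector

theorem ell_nonneg (L : ℝ) : 0 ≤ ell L := le_min (by positivity) (by norm_num)

theorem ell_sq_lt {L : ℝ} (hL : 1 < L) : ell L ^ 2 < L := by
  have hsqrt : 1 < √L := Real.lt_sqrt_of_sq_lt (by linarith)
  have hell : ell L < √L := (min_le_left _ _).trans_lt (by linarith)
  exact (Real.lt_sqrt (ell_nonneg L)).1 hell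

theorem harmonicLength_le_margin {s T t : ℤ} (hsT : s < T) (hTt : T < t) :
    harmonicLength s T t ≤ margin s T t := by
  rw [margin]
  push_cast
  exact le_min (harmonicLength_le_left hsT hTt) (harmonicLength_le_right hsT hTt)

theorem IsHighEnergy.sq_mul_scalePenalty_le {κ : ℝ} (hκ : 0 ≤ κ) (hq : 0 ≤ q) {θ : Fin n → ℝ}
    {τ : ChangePointVector n} {m : Fin (τ.len + 1) → ℝ} (hθ : HasChangePoints θ τ m)
    {k : Fin τ.len} (h : IsHighEnergy κ q θ τ k) :
    κ ^ 2 * scalePenalty n q (margin (τ.prev k) (τ.point k) (τ.next k)) ≤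
      height m k ^ 2 * margin (τ.prev k) (τ.point k) (τ.next k) := by
  have hsT := τ.prev_lt_point k
  have hTt := τ.point_lt_next k
  have hn : 0 < n := by have := τ.one_le_prev k; have := τ.next_le k; lia
  have hlen := harmonicLength_pos (Int.ofNat_lt.2 hsT) (Int.ofNat_lt.2 hTt)
  have hmargin := harmonicLength_le_margin (Int.ofNat_lt.2 hsT) (Int.ofNat_lt.2 hTt)
  have hmean_left : incrementMean (prefixSum θ) (τ.prev k) (τ.point k) = m k.castSucc :=
    hθ.incrementMean_eq k.castSucc le_rfl (Int.ofNat_lt.2 hsT) le_rfl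
  have hmean_right : incrementMean (prefixSum θ) (τ.point k) (τ.next k) = m k.succ :=
    hθ.incrementMean_eq k.succ le_rfl (Int.ofNat_lt.2 hTt) le_rfl
  calc κ ^ 2 * scalePenalty n q (margin (τ.prev k) (τ.point k) (τ.next k))
      ≤ κ ^ 2 * scalePenalty n q (harmonicLength (τ.prev k) (τ.point k) (τ.next k)) := by
        gcongr
        exact scalePenalty_anti q (by exact_mod_cast hn) hlen hmargin
    _ = (κ * psi n q (τ.prev k) (τ.point k) (τ.next k)) ^ 2 := by
        rw [mul_pow, psi_sq hq (τ.one_le_prev k) hsT hTt (τ.next_le k)]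
    _ ≤ |cusum θ (τ.prev k) (τ.point k) (τ.next k)| ^ 2 :=
        pow_le_pow_left₀ (mul_nonneg hκ (Real.sqrt_nonneg _)) h.le 2
    _ = height m k ^ 2 * harmonicLength (τ.prev k) (τ.point k) (τ.next k) := by
        rw [sq_abs, cusum_sq θ hsT hTt, cusumSq,
          hmean_left, hmean_right, height]
    _ ≤ height m k ^ 2 * margin (τ.prev k) (τ.point k) (τ.next k) := by gcongr

theorem cusumSq_le_of_mem_goodEvent {Ω : Type*} {L : ℝ} (hq : 0 ≤ q) {ε : Fin n → Ω → ℝ} {ω : Ω}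
    (hω : ω ∈ goodEvent L q ε) {a b c : ℤ} (ha : 1 ≤ a) (hab : a < b) (hbc : b < c)
    (hc : c ≤ n + 1) :
    cusumSq (prefixSum fun i => ε i ω) a b c ≤
      ell L ^ 2 * scalePenalty n q (harmonicLength a b c) := by
  lift a to ℕ using by lia
  lift b to ℕ using by lia
  lift c to ℕ using by lia
  rw [← cusum_sq _ (by lia) (by lia), ← psi_sq hq (by lia) (by lia) (by lia) (by lia), ← mul_pow,
    ← sq_abs]
  exact pow_le_pow_left₀ (abs_nonneg _) (hω a b c (by lia) (by lia) (by lia) (by lia)) 2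

theorem HasChangePoints.isNoisyJump {L d : ℝ} (hL : 1 < L) (hq : 3 < q) (hd : 0 < d)
    {θ : Fin n → ℝ} {τ : ChangePointVector n} {m : Fin (τ.len + 1) → ℝ}
    (hθ : HasChangePoints θ τ m) {k : Fin τ.len}
    (hk : IsHighEnergy (√(energyThreshold L (ell L))) q θ τ k) {Ω : Type*} {ε : Fin n → Ω → ℝ}
    {ω : Ω} (hω : ω ∈ goodEvent L q ε)
    (hright : ∀ a : ℤ, a ≤ n + 1 → d ≤ (a : ℝ) - (τ.point k : ℤ) →
      |incrementMean (prefixSum fun i => ε i ω) (τ.point k) a| ≤ |height m k| / 40)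
    (hleft : ∀ a : ℤ, 1 ≤ a → d ≤ ((τ.point k : ℤ) : ℝ) - a →
      |incrementMean (prefixSum fun i => ε i ω) a (τ.point k)| ≤ |height m k| / 40) :
    IsNoisyJump n L q (ell L) d (m k.castSucc) (m k.succ)
      (prefixSum fun i => θ i + ε i ω) (prefixSum fun i => ε i ω)
      (τ.prev k) (τ.point k) (τ.next k) := by
  have hprev := τ.one_le_prev k
  have hnext := τ.next_le k
  have hthr : 0 ≤ energyThreshold L (ell L) := by
    linarith [le_energyThreshold (by linarith) (ell_sq_lt hL)]
  refine
    { one_lt := hL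
      three_lt := hq
      sq_lt := ell_sq_lt hL
      left_lt := Int.ofNat_lt.2 (τ.prev_lt_point k)
      lt_right := Int.ofNat_lt.2 (τ.point_lt_next k)
      length_le := by have : τ.next k ≤ n + τ.prev k := by lia
                      rify at this; push_cast; linarith
      energy_le := Real.sq_sqrt hthr ▸
        hk.sq_mul_scalePenalty_le (Real.sqrt_nonneg _) (by linarith) hθ
      mean_left := fun a b => hθ.incrementMean_add _ k.castSucc
      mean_right := fun a b => hθ.incrementMean_add _ k.succ
      cusumSq_le := fun a b c ha hab hbc hc =>
        cusumSq_le_of_mem_goodEvent (by linarith) hω (by lia) hab hbc (by lia)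
      dist_pos := hd
      abs_noise_left_le := fun a ha => hleft a (by lia)
      abs_noise_right_le := fun a ha => hright a (by lia) }

theorem IsNoisyJump.distTo_lt {L e d μ₁ μ₂ : ℝ} {W : ℤ → ℝ} {s T t : ℕ} {Y : Fin n → ℝ}
    (h : IsNoisyJump n L q e d μ₁ μ₂ (prefixSum Y) W s T t) (hs : 1 ≤ s) (ht : t ≤ n + 1)
    {τ : ChangePointVector n} (hτ : IsPenalizedLeastSquares L q Y τ) :
    distTo τ T < ENNReal.ofReal d := by
  obtain ⟨p, hp, hsp, hpt, hclose⟩ := h.exists_mem_abs_sub_lt hτ.isLocallyOptimal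
    τ.one_mem_toList (by exact_mod_cast hs) τ.add_one_mem_toList (by exact_mod_cast ht)
  exact (ChangePointVector.distTo_le hp (by lia) (by lia) T).trans_lt
    ((ENNReal.ofReal_lt_ofReal_iff h.dist_pos).2 hclose)

end Translation

theorem proposition10_general {L q : ℝ} (hL : 1 < L) (hq : 3 < q) {n : ℕ} {θ : Fin n → ℝ}
    {τ : ChangePointVector n} {m : Fin (τ.len + 1) → ℝ} (hθ : HasChangePoints θ τ m)
    {Ω : Type*} [MeasurableSpace Ω] {P : Measure Ω} {ε : Fin n → Ω → ℝ} (hε : IsNoise P ε)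
    {τhat : Ω → ChangePointVector n}
    (hτhat : ∀ ω, IsPenalizedLeastSquares L q (fun i => θ i + ε i ω) (τhat ω)) {k : Fin τ.len}
    (hk : IsHighEnergy (√(energyThreshold L (ell L))) q θ τ k) {x : ℝ} (hx : 0 < x) :
    P.real {ω | ENNReal.ofReal (3200 * x / height m k ^ 2) ≤
        (goodEvent L q ε).indicator (fun ω => distTo (τhat ω) (τ.point k)) ω} ≤
      4 * Real.exp (-x) := by
  have := hε.indep.isProbabilityMeasure
  have hheight : height m k ≠ 0 := sub_ne_zero.2 (hθ.ne k).symm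
  set d := 3200 * x / height m k ^ 2 with hd
  have hd_pos : 0 < d := by positivity
  have hexponent : (|height m k| / 40) ^ 2 * d / 2 = x := by
    rw [div_pow, sq_abs, hd]
    field_simp
    norm_num
  have hright := hε.measureReal_exists_right_le (τ.point k) (r := |height m k| / 40)
    (by positivity) hd_pos
  have hleft := hε.measureReal_exists_left_le (τ.point k) (r := |height m k| / 40)
    (by positivity) hd_pos
  rw [hexponent] at hright hleft
  refine (measureReal_mono fun ω hω => ?_).trans
    ((measureReal_union_le _ _).trans ((add_le_add hright hleft).trans_eq (by ring)))
  by_contra hbad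
  rw [Set.mem_union, not_or] at hbad
  obtain ⟨hbad_right, hbad_left⟩ := hbad
  have hgood : ω ∈ goodEvent L q ε :=
    Set.mem_of_indicator_ne_zero ((ENNReal.ofReal_pos.2 hd_pos).trans_le hω).ne'
  have hjump := hθ.isNoisyJump hL hq hd_pos hk hgood
    (fun a ha hda => not_lt.1 fun hlt => hbad_right ⟨a, ha, hda, hlt⟩)
    (fun a ha hda => not_lt.1 fun hlt => hbad_left ⟨a, ha, hda, hlt⟩)
  have hdist := hjump.distTo_lt (τ.one_le_prev k) (τ.next_le k) (hτhat ω)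
  exact hdist.not_ge (hω.trans_eq (Set.indicator_of_mem hgood _))

theorem proposition10 :
    ∃ q₀ c₁ c c' : ℝ, 0 < q₀ ∧ 0 < c₁ ∧ 0 < c ∧ 0 < c' ∧
      ∀ L : ℝ, 1 < L → ∃ κ : ℝ, 1 < κ ∧
        ∀ q : ℝ, q₀ + c₁ * Real.log ((min L 2 - 1)⁻¹) < q →
        ∀ (n : ℕ) (θ : Fin n → ℝ) (τ : ChangePointVector n) (m : Fin (τ.len + 1) → ℝ),
          HasChangePoints θ τ m →
        ∀ (Ω : Type*) [MeasurableSpace Ω] (P : Measure Ω) [IsProbabilityMeasure P]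
          (ε : Fin n → Ω → ℝ), IsNoise P ε →
        ∀ τhat : Ω → ChangePointVector n,
          (∀ ω, IsPenalizedLeastSquares L q (fun i => θ i + ε i ω) (τhat ω)) →
        ∀ k : Fin τ.len, IsHighEnergy κ q θ τ k →
        ∀ x : ℝ, (1 + max (Real.log (L - 1)) 0 ≤ x ∨ 1 + max (Real.log ((L - 1)⁻¹)) 0 ≤ x) →
          P.real {ω | ENNReal.ofReal (c * x / (height m k) ^ 2) ≤
              (goodEvent L q ε).indicator (fun ω => distTo (τhat ω) (τ.point k)) ω}
            ≤ c' * Real.exp (-x) := by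
  refine ⟨3, 1, 3200, 4, by norm_num, by norm_num, by norm_num, by norm_num, fun L hL =>
    ⟨√(energyThreshold L (ell L)), ?_, ?_⟩⟩
  · rw [Real.lt_sqrt zero_le_one]
    linarith [le_energyThreshold (by linarith) (ell_sq_lt hL)]
  intro q hq n θ τ m hθ Ω _ P _ ε hε τhat hτhat k hk x hx
  have hmin : 1 < min L 2 := lt_min hL one_lt_two
  have hlog : 0 ≤ Real.log ((min L 2 - 1)⁻¹) :=
    Real.log_nonneg ((one_le_inv₀ (sub_pos.2 hmin)).2 (by linarith [min_le_right L 2]))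
  have hx_pos : 0 < x := by
    rcases hx with hx | hx <;> linarith [le_max_right (Real.log (L - 1)) 0,
      le_max_right (Real.log ((L - 1)⁻¹)) 0]
  exact proposition10_general hL (by linarith) hθ hε hτhat hk hx_pos
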